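/- Let $(\mathcal N,G)$ be a smooth two-dimensional manifold with a smooth Lorentzian metric of signature $(-,+)$, let $r:\mathcal N\to(0,\infty)$ be smooth, and let $(\mathcal M,g)$ be the spherically symmetric spacetime $\mathcal M=\mathcal N\times S^2$ with metric $$g=G_{AB}(x^C)\,dx^A dx^B+r^2(x^C)\,d\Omega^2 ,$$ where $d\Omega^2$ is the standard metric of the unit sphere. Let $\epsilon_{AB}$ be the totally antisymmetric tensor of $(\mathcal N,G)$ for a choice of orientation ($\epsilon_{01}=\sqrt{-\det G}$ in oriented coordinates), and let $K:=-(\epsilon^{AB}\partial_B r)\,\partial_A$ be the Kodama vector, regarded as a vector field on $\mathcal M$. Let $T_{ab}$ be the energy-momentum tensor of $(\mathcal M,g)$, which satisfies the Einstein equation $R_{ab}-\tfrac12 R\,g_{ab}=8\pi T_{ab}$ (units $c=G_{\mathrm{Newton}}=1$). Let $T_{\mathcal N}$ be the restriction of $T$ to the submanifolds $\mathcal N\times\{q\}$ orthogonal to the spheres of symmetry, let $\mathcal T_{ab}=(T_{\mathcal N})_{ab}-\tfrac12\,\mathrm{tr}_G(T_{\mathcal N})\,G_{ab}$ be its trace-free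 part, and let $\widetilde{\mathcal T}_{ab}=\epsilon_a{}^c\,\mathcal T_{cb}$ be the dual of $\mathcal T_{ab}$, regarded as a tensor on $\mathcal M$ whose components along the spheres vanish. Then, everywhere on $\mathcal M$, $$\nabla_{(a}K_{b)}=4\pi r\,\widetilde{\mathcal T}_{ab},$$ where $\nabla$ is the Levi-Civita connection of $g$ and $\nabla_{(a}K_{b)}=\tfrac12(\nabla_aK_b+\nabla_bK_a)$. -/

import Mathlib

open scoped Manifold ContDiff

noncomputable section

namespace Kodama

/-! ### Tensor fields and local coordinates on a manifold

`M` is a manifold without boundary, modelled on a finite-dimensional real vector space `E` with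
basis `b`.  At a point `p` tensors are computed in the coordinates `x^i` that the chart at `p` and
the basis `b` define; `x` runs through the image of this chart. -/

section Coordinates

variable {E : Type*} [NormedAddCommGroup E] [NormedSpace ℝ E]
  {H : Type*} [TopologicalSpace H] (I : ModelWithCorners ℝ E H)
  (M : Type*) [TopologicalSpace M] [ChartedSpace H M]

/-- Covariant tensor fields of rank two (no regularity is imposed). -/
abbrev TensorField2 : Type _ :=
  (p : M) → TangentSpace I p →L[ℝ] TangentSpace I p →L[ℝ] ℝ

/-- Vector fields (no regularity is imposed). -/
abbrev VectorField : Type _ := (p : M) → TangentSpace I p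

variable {M} {ι : Type*} [Fintype ι] [DecidableEq ι] (b : Module.Basis ι ℝ E)

/-- The coordinate vector field `∂_i` of the chart at `p`, at the point with coordinates `x`. -/
def coordVec (p : M) (x : E) (i : ι) : TangentSpace I ((extChartAt I p).symm x) :=
  mfderiv 𝓘(ℝ, E) I (extChartAt I p).symm x (b i)

/-- The components `v^i = dx^i(v)` of a tangent vector `v` at `p`, in the chart at `p`. -/
def coordComp (p : M) (v : TangentSpace I p) (i : ι) : ℝ :=
  b.repr (mfderiv I 𝓘(ℝ, E) (extChartAt I p) p v) i

/-- The components `g_{ij}` of a rank two tensor field in the chart at `p`. -/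
def tensorComp (g : TensorField2 I M) (p : M) (x : E) : Matrix ι ι ℝ :=
  Matrix.of fun i j =>
    g ((extChartAt I p).symm x) (coordVec I b p x i) (coordVec I b p x j)

/-- The covariant components `K_j = g_{jk} K^k` of a vector field in the chart at `p`. -/
def lowerComp (g : TensorField2 I M) (K : VectorField I M) (p : M) (x : E) (j : ι) : ℝ :=
  g ((extChartAt I p).symm x) (K ((extChartAt I p).symm x)) (coordVec I b p x j)

/-- The partial derivative `∂_i f` of a function of the coordinates. -/
def pderiv (f : E → ℝ) (i : ι) (x : E) : ℝ := fderiv ℝ f x (b i)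

/-- The Christoffel symbols `Γ^k_{ij} = ½ g^{kl} (∂_i g_{lj} + ∂_j g_{li} - ∂_l g_{ij})` of a
metric with components `γ`. -/
def christoffel (γ : E → Matrix ι ι ℝ) (k i j : ι) (x : E) : ℝ :=
  (1 / 2) * ∑ l, (γ x)⁻¹ k l *
    (pderiv b (fun y => γ y l j) i x + pderiv b (fun y => γ y l i) j x
      - pderiv b (fun y => γ y i j) l x)

/-- The Ricci tensor
`R_{ij} = ∂_k Γ^k_{ij} - ∂_j Γ^k_{ik} + Γ^k_{kl} Γ^l_{ij} - Γ^k_{jl} Γ^l_{ik}`. -/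
def ricciComp (γ : E → Matrix ι ι ℝ) (i j : ι) (x : E) : ℝ :=
  ∑ k, (pderiv b (christoffel b γ k i j) k x - pderiv b (christoffel b γ k i k) j x)
    + ∑ k, ∑ l, (christoffel b γ k k l x * christoffel b γ l i j x
        - christoffel b γ k j l x * christoffel b γ l i k x)

/-- The scalar curvature `R = g^{ij} R_{ij}`. -/
def scalarComp (γ : E → Matrix ι ι ℝ) (x : E) : ℝ :=
  ∑ i, ∑ j, (γ x)⁻¹ i j * ricciComp b γ i j x

/-- The Einstein tensor `R_{ij} - ½ R g_{ij}`. -/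
def einsteinComp (γ : E → Matrix ι ι ℝ) (i j : ι) (x : E) : ℝ :=
  ricciComp b γ i j x - (1 / 2) * scalarComp b γ x * γ x i j

/-- The covariant derivative `∇_i η_j = ∂_i η_j - Γ^k_{ij} η_k` of a covector field with
components `η`. -/
def covDerivComp (γ : E → Matrix ι ι ℝ) (η : E → ι → ℝ) (i j : ι) (x : E) : ℝ :=
  pderiv b (fun y => η y j) i x - ∑ k, christoffel b γ k i j x * η x k

/-- The Einstein tensor of the metric `g` at `p`, evaluated on two tangent vectors. -/
def einsteinTensor (g : TensorField2 I M) (p : M) (v w : TangentSpace I p) : ℝ :=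
  ∑ i, ∑ j, coordComp I b p v i * coordComp I b p w j *
    einsteinComp b (tensorComp I b g p) i j (extChartAt I p p)

/-- The symmetrized covariant derivative `∇_{(a} K_{b)} = ½ (∇_a K_b + ∇_b K_a)` of a vector
field `K`, with respect to the Levi-Civita connection of `g`, at `p`, evaluated on two tangent
vectors. -/
def symCovDeriv (g : TensorField2 I M) (K : VectorField I M) (p : M)
    (v w : TangentSpace I p) : ℝ :=
  ∑ i, ∑ j, coordComp I b p v i * coordComp I b p w j *
    ((1 / 2) *
      (covDerivComp b (tensorComp I b g p) (lowerComp I b g K p) i j (extChartAt I p p)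
        + covDerivComp b (tensorComp I b g p) (lowerComp I b g K p) j i (extChartAt I p p)))

/-- The Einstein equation `R_{ab} - ½ R g_{ab} = 8π T_{ab}`, in units with `c = G = 1`. -/
def EinsteinEquation (g T : TensorField2 I M) : Prop :=
  ∀ (p : M) (v w : TangentSpace I p), einsteinTensor I b g p v w = 8 * Real.pi * T p v w

end Coordinates

/-! ### The two-dimensional orbit space, the sphere, and the spacetime -/

/-- The model space of the orbit space and of the sphere. -/
abbrev Plane : Type := EuclideanSpace ℝ (Fin 2)

/-- The unit sphere in three-dimensional Euclidean space. -/
abbrev S2 : Type := Metric.sphere (0 : EuclideanSpace ℝ (Fin 3)) 1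

/-- The standard basis of the model space of the four-dimensional spacetime. -/
def basis4 : Module.Basis (Fin 2 ⊕ Fin 2) ℝ (Plane × Plane) :=
  (EuclideanSpace.basisFun (Fin 2) ℝ).toBasis.prod (EuclideanSpace.basisFun (Fin 2) ℝ).toBasis

/-- The data `(N, G, r)` of a spherically symmetric spacetime, together with an orientation of
`N`: a smooth Lorentzian metric `G` (signature `(-,+)`), a smooth positive function `r`, and a
smooth totally antisymmetric tensor `ε` with `ε(v,w)² = - det (G restricted to v, w)`.  In oriented
coordinates the last condition says `ε_{01} = √(-det G)`; there is one such `ε` for each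
orientation. -/
structure OrbitData (N : Type*) [TopologicalSpace N] [ChartedSpace Plane N]
    [IsManifold (𝓡 2) ∞ N] where
  /-- the metric of the orbit space -/
  G : TensorField2 (𝓡 2) N
  G_smooth : ContMDiff (𝓡 2) ((𝓡 2).prod 𝓘(ℝ, Plane →L[ℝ] Plane →L[ℝ] ℝ)) ∞
    (fun p : N => (Bundle.TotalSpace.mk' (Plane →L[ℝ] Plane →L[ℝ] ℝ) p (G p) :
      Bundle.TotalSpace (Plane →L[ℝ] Plane →L[ℝ] ℝ)
        (fun p : N => TangentSpace (𝓡 2) p →L[ℝ] TangentSpace (𝓡 2) p →L[ℝ] ℝ)))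
  G_symm : ∀ (p : N) (v w : TangentSpace (𝓡 2) p), G p v w = G p w v
  G_lorentz : ∀ p : N, ∃ t : TangentSpace (𝓡 2) p,
    G p t t < 0 ∧ ∀ v : TangentSpace (𝓡 2) p, v ≠ 0 → G p t v = 0 → 0 < G p v v
  /-- the areal radius -/
  r : N → ℝ
  r_smooth : ContMDiff (𝓡 2) 𝓘(ℝ, ℝ) ∞ r
  r_pos : ∀ p, 0 < r p
  /-- the totally antisymmetric tensor of the orbit space -/
  ε : TensorField2 (𝓡 2) N
  ε_smooth : ContMDiff (𝓡 2) ((𝓡 2).prod 𝓘(ℝ, Plane →L[ℝ] Plane →L[ℝ] ℝ)) ∞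
    (fun p : N => (Bundle.TotalSpace.mk' (Plane →L[ℝ] Plane →L[ℝ] ℝ) p (ε p) :
      Bundle.TotalSpace (Plane →L[ℝ] Plane →L[ℝ] ℝ)
        (fun p : N => TangentSpace (𝓡 2) p →L[ℝ] TangentSpace (𝓡 2) p →L[ℝ] ℝ)))
  ε_antisymm : ∀ (p : N) (v w : TangentSpace (𝓡 2) p), ε p v w = - ε p w v
  ε_normalized : ∀ (p : N) (v w : TangentSpace (𝓡 2) p),
    ε p v w ^ 2 = - (G p v v * G p w w - G p v w ^ 2)

/-- The model with corners (without boundary) of the spacetime `N × S²`. -/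
abbrev I4 : ModelWithCorners ℝ (Plane × Plane) (ModelProd Plane Plane) := (𝓡 2).prod (𝓡 2)

/-- The bilinear form `(v, w) ↦ B (A v) (A w)`. -/
def pullbackForm {V W : Type*} [AddCommGroup V] [Module ℝ V] [TopologicalSpace V]
    [AddCommGroup W] [Module ℝ W] [TopologicalSpace W]
    (A : V →L[ℝ] W) (B : W →L[ℝ] W →L[ℝ] ℝ) : V →L[ℝ] V →L[ℝ] ℝ :=
  ContinuousLinearMap.precomp ℝ A ∘L B ∘L A

namespace OrbitData

variable {N : Type*} [TopologicalSpace N] [ChartedSpace Plane N] [IsManifold (𝓡 2) ∞ N]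
  (S : OrbitData N)

/-- The differential `T_{(p,q)} (N × S²) → T_p N` of the projection to the orbit space. -/
def dProj (m : N × S2) : TangentSpace I4 m →L[ℝ] TangentSpace (𝓡 2) m.1 :=
  mfderiv I4 (𝓡 2) (Prod.fst : N × S2 → N) m

/-- The differential `T_p N → T_{(p,q)} (N × S²)` of the inclusion of `N` as the submanifold
`N × {q}`, which is orthogonal to the spheres of symmetry. -/
def dIncl (m : N × S2) : TangentSpace (𝓡 2) m.1 →L[ℝ] TangentSpace I4 m :=
  mfderiv (𝓡 2) I4 (fun p : N => ((p, m.2) : N × S2)) m.1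

/-- The differential of the map `(p, q) ↦ q ∈ ℝ³`. -/
def dSphere (m : N × S2) : TangentSpace I4 m →L[ℝ] EuclideanSpace ℝ (Fin 3) :=
  mfderiv I4 𝓘(ℝ, EuclideanSpace ℝ (Fin 3))
    (fun x : N × S2 => (x.2 : EuclideanSpace ℝ (Fin 3))) m

/-- The spacetime metric `g = G_{AB} dx^A dx^B + r² dΩ²` on `N × S²`; here `dΩ²` is the metric
that the Euclidean metric of `ℝ³` induces on the unit sphere. -/
def spacetimeMetric : TensorField2 I4 (N × S2) := fun m =>
  pullbackForm (dProj m) (S.G m.1) + (S.r m.1) ^ 2 • pullbackForm (dSphere m) (innerSL ℝ)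

/-- Raising an index with `G`: the vector `X` with `G(X, ·) = η`. -/
def sharp (p : N) : (TangentSpace (𝓡 2) p →L[ℝ] ℝ) →L[ℝ] TangentSpace (𝓡 2) p :=
  (S.G p).inverse

/-- The differential `dr`. -/
def dr (p : N) : TangentSpace (𝓡 2) p →L[ℝ] ℝ := mfderiv (𝓡 2) 𝓘(ℝ, ℝ) S.r p

/-- The Kodama vector `K = -(ε^{AB} ∂_B r) ∂_A` on the orbit space; with its index lowered,
`K_A = -ε_{AB} (grad r)^B = (grad r)^B ε_{BA}`. -/
def kodamaOrbit : VectorField (𝓡 2) N := fun p =>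
  S.sharp p (S.ε p (S.sharp p (S.dr p)))

/-- The Kodama vector field of the spacetime: it is tangent to the submanifolds `N × {q}`. -/
def kodama : VectorField I4 (N × S2) := fun m => dIncl m (S.kodamaOrbit m.1)

/-- The restriction `T_N` of a spacetime tensor field `T` to the submanifold `N × {q}`, at
`m = (p, q)`. -/
def restrict (T : TensorField2 I4 (N × S2)) (m : N × S2) :
    TangentSpace (𝓡 2) m.1 →L[ℝ] TangentSpace (𝓡 2) m.1 →L[ℝ] ℝ :=
  pullbackForm (dIncl m) (T m)

/-- The trace `tr_G A = G^{AB} A_{AB}` of a bilinear form on `T_p N`. -/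
def traceG (p : N) (A : TangentSpace (𝓡 2) p →L[ℝ] TangentSpace (𝓡 2) p →L[ℝ] ℝ) : ℝ :=
  LinearMap.trace ℝ (TangentSpace (𝓡 2) p)
    ((S.sharp p ∘L A : TangentSpace (𝓡 2) p →L[ℝ] TangentSpace (𝓡 2) p) :
      TangentSpace (𝓡 2) p →ₗ[ℝ] TangentSpace (𝓡 2) p)

/-- The trace-free part `𝒯 = T_N - ½ tr_G(T_N) G`. -/
def traceFree (T : TensorField2 I4 (N × S2)) (m : N × S2) :
    TangentSpace (𝓡 2) m.1 →L[ℝ] TangentSpace (𝓡 2) m.1 →L[ℝ] ℝ :=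
  restrict T m - ((1 / 2 : ℝ) * S.traceG m.1 (restrict T m)) • S.G m.1

/-- The dual `ε_a{}^c 𝒯_{cb}` on `T_p N`; the vector `v^a ε_a{}^c` is `sharp (ε(v, ·))`. -/
def dualOrbit (T : TensorField2 I4 (N × S2)) (m : N × S2)
    (v w : TangentSpace (𝓡 2) m.1) : ℝ :=
  S.traceFree T m (S.sharp m.1 (S.ε m.1 v)) w

/-- The dual as a tensor field on the spacetime: a tensor on the orbit space is regarded as a
spacetime tensor whose components along the spheres vanish. -/
def dual (T : TensorField2 I4 (N × S2)) (m : N × S2) (v w : TangentSpace I4 m) : ℝ :=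
  S.dualOrbit T m (dProj m v) (dProj m w)

end OrbitData

end Kodama

end

/-!
The identity is checked in the product chart at a point `m = (p, q)`. There the spacetime metric is
a warped product, `g_{AB}(x)` on the orbit space and `ρ(x)² Ω_{ij}(y)` on the sphere, and nothing
about the sphere matters except that `Ω` is differentiable and nondegenerate.

*Curvature.* For a warped product with an `n`-dimensional fibre the base components of the Ricci
tensor are `R_{AB} = ᴺR_{AB} - (n / ρ) ∇_A ∂_B ρ` (`ricciComp_warped_inl_inl`), and in two dimensions
`ᴺR_{AB}` is a multiple of `g_{AB}` (`exists_ricciComp_eq`). The scalar curvature term of the Einstein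
tensor is a multiple of `g_{AB}` as well, so the Einstein equation determines the trace-free part of
`T_N`: it is `-1 / (4πr)` times the trace-free part of the Hessian of `r`.

*Kodama vector.* Its covariant components are `K_B = (grad r)^C ε_{CB}` on the orbit space and zero on
the sphere (`lowerComp_kodama`). The mixed components of `∇_{(a} K_{b)}` vanish, the sphere components
are proportional to `K(grad r) = ε(grad r, grad r) = 0`, and the orbit space components are those of
the two-dimensional connection (`symCovDerivComp_kodama`). Since `ε` is parallel, they come from the
Hessian alone; its trace contributes the antisymmetric `ε_{AB}` and drops out, which leaves
`-ε_A{}^C` contracted with the trace-free Hessian (`symCovDeriv_kodamaComp`). By the Einstein equation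
this is `4πr ε_A{}^C 𝒯_{CB}`.

The passage from tensors to components uses that the preferred chart at `m` induces the identity on
the tangent space at `m` (`coordComp_self`, `tensorComp_self`), and that raising an index with `G` is
multiplication by the inverse matrix (`isInvertible_form`).
-/

noncomputable section

namespace Kodama

open Filter Topology Sum

/-! ### Calculus in coordinates -/

section Calculus

variable {E F : Type*} [NormedAddCommGroup E] [NormedSpace ℝ E]
  [NormedAddCommGroup F] [NormedSpace ℝ F] {ι κ : Type*}
  (b : Module.Basis ι ℝ E) (c : Module.Basis κ ℝ F)

theorem pderiv_congr {f f' : E → ℝ} {x : E} (h : f =ᶠ[𝓝 x] f') (i : ι) :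
    pderiv b f i x = pderiv b f' i x := by
  simp only [pderiv, h.fderiv_eq]

theorem pderiv_const (a : ℝ) (i : ι) (x : E) : pderiv b (fun _ => a) i x = 0 := by
  simp [pderiv]

theorem pderiv_add {f h : E → ℝ} {x : E} (hf : DifferentiableAt ℝ f x)
    (hh : DifferentiableAt ℝ h x) (i : ι) :
    pderiv b (fun y => f y + h y) i x = pderiv b f i x + pderiv b h i x := by
  simp [pderiv, fderiv_fun_add hf hh]

theorem pderiv_sub {f h : E → ℝ} {x : E} (hf : DifferentiableAt ℝ f x)
    (hh : DifferentiableAt ℝ h x) (i : ι) :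
    pderiv b (fun y => f y - h y) i x = pderiv b f i x - pderiv b h i x := by
  simp [pderiv, fderiv_fun_sub hf hh]

theorem pderiv_neg (f : E → ℝ) (x : E) (i : ι) :
    pderiv b (fun y => - f y) i x = - pderiv b f i x := by
  simp [pderiv, fderiv_fun_neg]

theorem pderiv_mul {f h : E → ℝ} {x : E} (hf : DifferentiableAt ℝ f x)
    (hh : DifferentiableAt ℝ h x) (i : ι) :
    pderiv b (fun y => f y * h y) i x = pderiv b f i x * h x + f x * pderiv b h i x := by
  simp [pderiv, fderiv_fun_mul hf hh]; ring

theorem pderiv_inv {f : E → ℝ} {x : E} (hf : DifferentiableAt ℝ f x) (h0 : f x ≠ 0) (i : ι) :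
    pderiv b (fun y => (f y)⁻¹) i x = - pderiv b f i x / f x ^ 2 := by
  have := (hasDerivAt_inv h0).comp_hasFDerivAt x hf.hasFDerivAt
  have e : fderiv ℝ (fun y => (f y)⁻¹) x = -(f x ^ 2)⁻¹ • fderiv ℝ f x := this.fderiv
  simp only [pderiv, e, _root_.smul_apply, smul_eq_mul]
  ring

theorem pderiv_contDiffAt {f : E → ℝ} {x : E} (hf : ContDiffAt ℝ ∞ f x) (i : ι) :
    ContDiffAt ℝ ∞ (pderiv b f i) x :=
  (hf.fderiv_right (m := ∞) (by simp)).clm_apply contDiffAt_const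

/-- Partial derivatives commute. -/
theorem pderiv_comm {f : E → ℝ} {x : E} (hf : ContDiffAt ℝ ∞ f x) (i j : ι) :
    pderiv b (pderiv b f i) j x = pderiv b (pderiv b f j) i x := by
  have hs := hf.isSymmSndFDerivAt (by simpa using WithTop.coe_le_coe.2 (le_top (a := (2 : ℕ∞))))
  have hd : DifferentiableAt ℝ (fderiv ℝ f) x :=
    (hf.fderiv_right (m := ∞) (by simp)).differentiableAt (by simp)
  have e : ∀ i j, pderiv b (pderiv b f i) j x = fderiv ℝ (fderiv ℝ f) x (b j) (b i) := by
    intro i j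
    have : pderiv b f i = fun y => fderiv ℝ f y (b i) := rfl
    rw [this, pderiv, fderiv_clm_apply hd (differentiableAt_const _)]
    simp
  rw [e, e, hs.eq]

theorem differentiableAt_of_comp_fst {f : E → ℝ} {z : E × F}
    (h : DifferentiableAt ℝ (fun y : E × F => f y.1) z) : DifferentiableAt ℝ f z.1 := by
  have h2 : DifferentiableAt ℝ (fun x : E => (x, z.2)) z.1 := by fun_prop
  exact DifferentiableAt.comp (g := fun y : E × F => f y.1) z.1 h h2

/-- No differentiability is needed: if `f` is not differentiable, neither is `f ∘ Prod.fst`, and both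
derivatives have the junk value zero. -/
theorem pderiv_comp_fst_inl (f : E → ℝ) (i : ι) (z : E × F) :
    pderiv (b.prod c) (fun y => f y.1) (inl i) z = pderiv b f i z.1 := by
  by_cases hf : DifferentiableAt ℝ f z.1
  · have := (hf.hasFDerivAt.comp z hasFDerivAt_fst).fderiv
    simp only [Function.comp_def] at this
    simp [pderiv, this]
  · have hf' : ¬ DifferentiableAt ℝ (fun y : E × F => f y.1) z :=
      fun h => hf (differentiableAt_of_comp_fst h)
    simp [pderiv, fderiv_zero_of_not_differentiableAt hf,
      fderiv_zero_of_not_differentiableAt hf']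

theorem pderiv_comp_fst_inr (f : E → ℝ) (i : κ) (z : E × F) :
    pderiv (b.prod c) (fun y => f y.1) (inr i) z = 0 := by
  by_cases hf : DifferentiableAt ℝ f z.1
  · have := (hf.hasFDerivAt.comp z hasFDerivAt_fst).fderiv
    simp only [Function.comp_def] at this
    simp [pderiv, this]
  · have hf' : ¬ DifferentiableAt ℝ (fun y : E × F => f y.1) z :=
      fun h => hf (differentiableAt_of_comp_fst h)
    simp [pderiv, fderiv_zero_of_not_differentiableAt hf']

theorem pderiv_mul_prod_inl {f : E → ℝ} {h : F → ℝ} {z : E × F} (hf : DifferentiableAt ℝ f z.1)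
    (hh : DifferentiableAt ℝ h z.2) (i : ι) :
    pderiv (b.prod c) (fun y => f y.1 * h y.2) (inl i) z = pderiv b f i z.1 * h z.2 := by
  have := ((hf.hasFDerivAt.comp z hasFDerivAt_fst).mul
    (hh.hasFDerivAt.comp z hasFDerivAt_snd)).fderiv
  have e : fderiv ℝ (fun y : E × F => f y.1 * h y.2) z = _ := this
  simp [pderiv, e]; ring

variable [Fintype ι] [DecidableEq ι]

theorem christoffel_eventuallyEq {γ γ' : E → Matrix ι ι ℝ} {x : E} (h : γ =ᶠ[𝓝 x] γ')
    (k i j : ι) : christoffel b γ k i j =ᶠ[𝓝 x] christoffel b γ' k i j := by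
  have h' : ∀ᶠ y in 𝓝 x, γ =ᶠ[𝓝 y] γ' := h.eventuallyEq_nhds
  filter_upwards [h'] with y hy
  have e : ∀ i j, (fun z => γ z i j) =ᶠ[𝓝 y] fun z => γ' z i j := fun i j =>
    hy.mono fun z hz => by simp only [hz]
  simp only [christoffel, hy.eq_of_nhds, pderiv_congr b (e _ _)]

theorem ricciComp_congr {γ γ' : E → Matrix ι ι ℝ} {x : E} (h : γ =ᶠ[𝓝 x] γ') (i j : ι) :
    ricciComp b γ i j x = ricciComp b γ' i j x := by
  have e := fun k i j => christoffel_eventuallyEq b h k i j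
  simp only [ricciComp, pderiv_congr b (e _ _ _), (e _ _ _).eq_of_nhds]

theorem covDerivComp_congr {γ γ' : E → Matrix ι ι ℝ} {η η' : E → ι → ℝ} {x : E}
    (h : γ =ᶠ[𝓝 x] γ') (hη : η =ᶠ[𝓝 x] η') (i j : ι) :
    covDerivComp b γ η i j x = covDerivComp b γ' η' i j x := by
  have e := fun k i j => christoffel_eventuallyEq b h k i j
  have e' : ∀ j, (fun z => η z j) =ᶠ[𝓝 x] fun z => η' z j := fun j =>
    hη.mono fun z hz => by simp only [hz]
  simp only [covDerivComp, pderiv_congr b (e' _), (e _ _ _).eq_of_nhds, hη.eq_of_nhds]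

/-- The components `∇_i ∂_j f` of the Hessian of a function with respect to the Levi-Civita
connection of the metric with components `γ`. -/
def hessComp (γ : E → Matrix ι ι ℝ) (f : E → ℝ) (i j : ι) (x : E) : ℝ :=
  pderiv b (pderiv b f j) i x - ∑ k, christoffel b γ k i j x * pderiv b f k x

end Calculus

/-! ### Curvature of warped products -/

section Warped

variable {E F : Type*} [NormedAddCommGroup E] [NormedSpace ℝ E]
  [NormedAddCommGroup F] [NormedSpace ℝ F]
  {ι κ : Type*}
  (b : Module.Basis ι ℝ E) (c : Module.Basis κ ℝ F)

/-- The components of the warped product metric `g_{AB} dx^A dx^B + ρ² Ω_{ij} dy^i dy^j`, where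
`g` and `ρ` depend on `x` and `Ω` depends on `y`. -/
def warped (g : E → Matrix ι ι ℝ) (ρ : E → ℝ) (Ω : F → Matrix κ κ ℝ) (z : E × F) :
    Matrix (ι ⊕ κ) (ι ⊕ κ) ℝ :=
  Matrix.fromBlocks (g z.1) 0 0 (ρ z.1 ^ 2 • Ω z.2)

variable {g : E → Matrix ι ι ℝ} {ρ : E → ℝ} {Ω : F → Matrix κ κ ℝ} {z : E × F}

theorem pderiv_warped_inl_inl (A B : ι) (k : ι ⊕ κ) :
    pderiv (b.prod c) (fun y => warped g ρ Ω y (inl A) (inl B)) k z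
      = Sum.elim (fun C => pderiv b (fun x => g x A B) C z.1) (fun _ => 0) k := by
  have e : (fun y => warped g ρ Ω y (inl A) (inl B)) =
      fun y : E × F => (fun x => g x A B) y.1 := by
    funext y; simp [warped]
  rw [e]
  cases k with
  | inl C => exact pderiv_comp_fst_inl b c (fun x => g x A B) C z
  | inr i => exact pderiv_comp_fst_inr b c (fun x => g x A B) i z

theorem pderiv_warped_inl_inr (A : ι) (i : κ) (k : ι ⊕ κ) :
    pderiv (b.prod c) (fun y => warped g ρ Ω y (inl A) (inr i)) k z = 0 := by
  simp [warped, pderiv_const]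

theorem pderiv_warped_inr_inl (A : ι) (i : κ) (k : ι ⊕ κ) :
    pderiv (b.prod c) (fun y => warped g ρ Ω y (inr i) (inl A)) k z = 0 := by
  simp [warped, pderiv_const]

variable [Fintype ι] [DecidableEq ι] [Fintype κ] [DecidableEq κ]

/-- The pointwise regularity under which the Christoffel symbols of a warped product are computed:
the base and fibre metrics are nondegenerate, the warping function does not vanish, and the
warping function and the fibre metric are differentiable. -/
structure WarpedRegular (g : E → Matrix ι ι ℝ) (ρ : E → ℝ) (Ω : F → Matrix κ κ ℝ)
    (z : E × F) : Prop where
  base_det : (g z.1).det ≠ 0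
  fibre_det : (Ω z.2).det ≠ 0
  warp_ne_zero : ρ z.1 ≠ 0
  warp_diff : DifferentiableAt ℝ ρ z.1
  fibre_diff : ∀ i j, DifferentiableAt ℝ (fun y => Ω y i j) z.2

theorem warped_inv (h : WarpedRegular g ρ Ω z) :
    (warped g ρ Ω z)⁻¹ = Matrix.fromBlocks (g z.1)⁻¹ 0 0 ((ρ z.1 ^ 2)⁻¹ • (Ω z.2)⁻¹) := by
  have h1 : IsUnit (g z.1).det := h.base_det.isUnit
  have h2 : IsUnit (Ω z.2).det := h.fibre_det.isUnit
  have h3 := h.warp_ne_zero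
  refine Matrix.inv_eq_right_inv ?_
  rw [warped, Matrix.fromBlocks_multiply]
  simp [Matrix.mul_nonsing_inv _ h1, Matrix.mul_nonsing_inv _ h2, smul_smul, h3]

theorem pderiv_warped_inr_inr_inl (h : WarpedRegular g ρ Ω z) (i j : κ) (A : ι) :
    pderiv (b.prod c) (fun y => warped g ρ Ω y (inr i) (inr j)) (inl A) z
      = 2 * ρ z.1 * pderiv b ρ A z.1 * Ω z.2 i j := by
  have hd := h.warp_diff
  have e : (fun y => warped g ρ Ω y (inr i) (inr j)) =
      fun y : E × F => (fun x => ρ x * ρ x) y.1 * (fun x => Ω x i j) y.2 := by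
    funext y; simp only [warped, Matrix.fromBlocks_apply₂₂, Matrix.smul_apply, smul_eq_mul]; ring
  rw [e, pderiv_mul_prod_inl b c (hd.fun_mul hd) (h.fibre_diff i j), pderiv_mul b hd hd]
  ring

theorem christoffel_warped_inl_inl_inl (h : WarpedRegular g ρ Ω z) (C A B : ι) :
    christoffel (b.prod c) (warped g ρ Ω) (inl C) (inl A) (inl B) z
      = christoffel b g C A B z.1 := by
  simp [christoffel, warped_inv h, pderiv_warped_inl_inl]

theorem christoffel_warped_inr_inl_inl (h : WarpedRegular g ρ Ω z) (i : κ) (A B : ι) :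
    christoffel (b.prod c) (warped g ρ Ω) (inr i) (inl A) (inl B) z = 0 := by
  simp [christoffel, warped_inv h, pderiv_warped_inl_inl, pderiv_warped_inr_inl]

theorem christoffel_warped_inl_inl_inr (h : WarpedRegular g ρ Ω z) (i : κ) (A C : ι) :
    christoffel (b.prod c) (warped g ρ Ω) (inl C) (inl A) (inr i) z = 0 := by
  simp [christoffel, warped_inv h, pderiv_warped_inl_inl, pderiv_warped_inl_inr]

theorem christoffel_warped_inl_inr_inl (h : WarpedRegular g ρ Ω z) (i : κ) (A C : ι) :
    christoffel (b.prod c) (warped g ρ Ω) (inl C) (inr i) (inl A) z = 0 := by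
  simp [christoffel, warped_inv h, pderiv_warped_inl_inl, pderiv_warped_inl_inr,
    pderiv_warped_inr_inl]

/-- The contraction of the inverse fibre metric with `∂_A (ρ² Ω)`, where `a` stands for `∂_A ρ`. -/
theorem sum_inv_mul_fibre (h : WarpedRegular g ρ Ω z) (i j : κ) (a : ℝ) :
    (1 / 2) * ∑ l, (ρ z.1 ^ 2)⁻¹ * (Ω z.2)⁻¹ i l * (2 * ρ z.1 * a * Ω z.2 l j)
      = if i = j then a / ρ z.1 else 0 := by
  have h2 : IsUnit (Ω z.2).det := h.fibre_det.isUnit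
  have h3 := h.warp_ne_zero
  have e := congrFun (congrFun (Matrix.nonsing_inv_mul _ h2) i) j
  rw [Matrix.mul_apply, Matrix.one_apply] at e
  have : (1 / 2) * ∑ l, (ρ z.1 ^ 2)⁻¹ * (Ω z.2)⁻¹ i l * (2 * ρ z.1 * a * Ω z.2 l j)
      = (a / ρ z.1) * ∑ l, (Ω z.2)⁻¹ i l * Ω z.2 l j := by
    rw [Finset.mul_sum, Finset.mul_sum]
    refine Finset.sum_congr rfl fun l _ => ?_
    field_simp
  rw [this, e]; simp

theorem christoffel_warped_inr_inl_inr (h : WarpedRegular g ρ Ω z) (i j : κ) (A : ι) :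
    christoffel (b.prod c) (warped g ρ Ω) (inr i) (inl A) (inr j) z
      = if i = j then pderiv b ρ A z.1 / ρ z.1 else 0 := by
  rw [← sum_inv_mul_fibre h]
  simp [christoffel, warped_inv h, pderiv_warped_inl_inr, pderiv_warped_inr_inl,
    pderiv_warped_inr_inr_inl b c h]

theorem christoffel_warped_inr_inr_inl (h : WarpedRegular g ρ Ω z) (i j : κ) (A : ι) :
    christoffel (b.prod c) (warped g ρ Ω) (inr i) (inr j) (inl A) z
      = if i = j then pderiv b ρ A z.1 / ρ z.1 else 0 := by
  rw [← sum_inv_mul_fibre h]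
  simp [christoffel, warped_inv h, pderiv_warped_inl_inr, pderiv_warped_inr_inl,
    pderiv_warped_inr_inr_inl b c h]

theorem christoffel_warped_inl_inr_inr (h : WarpedRegular g ρ Ω z) (i j : κ) (C : ι) :
    christoffel (b.prod c) (warped g ρ Ω) (inl C) (inr i) (inr j) z
      = - (ρ z.1 * Ω z.2 i j) * ∑ D, (g z.1)⁻¹ C D * pderiv b ρ D z.1 := by
  simp only [christoffel, warped_inv h, pderiv_warped_inl_inr, pderiv_warped_inr_inr_inl b c h,
    Fintype.sum_sum_type, Matrix.fromBlocks_apply₁₁, Matrix.fromBlocks_apply₁₂, Matrix.zero_apply,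
    zero_mul, Finset.sum_const_zero, add_zero]
  rw [Finset.mul_sum, Finset.mul_sum]
  refine Finset.sum_congr rfl fun l _ => ?_
  ring

/-- The base components of the Ricci tensor of a warped product whose fibre has dimension `n`
differ from the Ricci tensor of the base by `-(n / ρ) ∇_A ∂_B ρ`. -/
theorem ricciComp_warped_inl_inl (h : ∀ᶠ y in 𝓝 z, WarpedRegular g ρ Ω y)
    (hρ : ContDiffAt ℝ ∞ ρ z.1) (A B : ι) :
    ricciComp (b.prod c) (warped g ρ Ω) (inl A) (inl B) z
      = ricciComp b g A B z.1 - Fintype.card κ / ρ z.1 * hessComp b g ρ A B z.1 := by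
  have h0 := h.self_of_nhds
  have hρ0 := h0.warp_ne_zero
  have d1 : ∀ C A B D, pderiv (b.prod c)
      (christoffel (b.prod c) (warped g ρ Ω) (inl C) (inl A) (inl B)) (inl D) z
        = pderiv b (christoffel b g C A B) D z.1 := fun C A B D => by
    rw [pderiv_congr (f' := fun y : E × F => christoffel b g C A B y.1) (b.prod c)
      (h.mono fun y hy => christoffel_warped_inl_inl_inl b c hy C A B), pderiv_comp_fst_inl]
  have d2 : ∀ i, pderiv (b.prod c)
      (christoffel (b.prod c) (warped g ρ Ω) (inr i) (inl A) (inl B)) (inr i) z = 0 := fun i => by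
    rw [pderiv_congr (f' := fun _ => (0 : ℝ)) (b.prod c)
      (h.mono fun y hy => christoffel_warped_inr_inl_inl b c hy i A B), pderiv_const]
  have d3 : ∀ i, pderiv (b.prod c)
      (christoffel (b.prod c) (warped g ρ Ω) (inr i) (inl A) (inr i)) (inl B) z
        = pderiv b (pderiv b ρ A) B z.1 / ρ z.1
          - pderiv b ρ A z.1 * pderiv b ρ B z.1 / ρ z.1 ^ 2 := fun i => by
    rw [pderiv_congr (f' := fun y : E × F => (fun x => pderiv b ρ A x * (ρ x)⁻¹) y.1) (b.prod c)
      (h.mono fun y hy => by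
        rw [christoffel_warped_inr_inl_inr b c hy i i A, if_pos rfl, div_eq_mul_inv]),
      pderiv_comp_fst_inl b c (fun x => pderiv b ρ A x * (ρ x)⁻¹),
      pderiv_mul b ((pderiv_contDiffAt b hρ A).differentiableAt (by simp))
        (h0.warp_diff.fun_inv hρ0), pderiv_inv b h0.warp_diff hρ0]
    ring
  simp only [ricciComp, hessComp, Fintype.sum_sum_type, d1, d2, d3,
    christoffel_warped_inl_inl_inl b c h0, christoffel_warped_inr_inl_inl b c h0,
    christoffel_warped_inl_inl_inr b c h0, christoffel_warped_inr_inl_inr b c h0,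
    christoffel_warped_inr_inr_inl b c h0, if_true, pderiv_comm b hρ B A]
  simp only [mul_zero, zero_mul, sub_zero, zero_sub, add_zero, Finset.sum_const_zero,
    Finset.sum_add_distrib, Finset.sum_const, Finset.card_univ, nsmul_eq_mul, ite_mul, mul_ite,
    Finset.sum_neg_distrib, Finset.sum_sub_distrib]
  have e : ∑ C, pderiv b ρ C z.1 / ρ z.1 * christoffel b g C A B z.1
      = (∑ C, christoffel b g C A B z.1 * pderiv b ρ C z.1) / ρ z.1 := by
    rw [Finset.sum_div]
    exact Finset.sum_congr rfl fun C _ => by ring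
  simp [e]
  field_simp
  ring

/-- For a covector field that is pulled back from the base, the base components of the covariant
derivative are those of the base. -/
theorem covDerivComp_warped_inl_inl (h : WarpedRegular g ρ Ω z) (η : E → ι → ℝ) (A B : ι) :
    covDerivComp (b.prod c) (warped g ρ Ω) (fun y => Sum.elim (η y.1) 0) (inl A) (inl B) z
      = covDerivComp b g η A B z.1 := by
  simp [covDerivComp, christoffel_warped_inl_inl_inl b c h,
    pderiv_comp_fst_inl b c (fun x => η x B)]

theorem covDerivComp_warped_inl_inr (h : WarpedRegular g ρ Ω z) (η : E → ι → ℝ) (A : ι) (i : κ) :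
    covDerivComp (b.prod c) (warped g ρ Ω) (fun y => Sum.elim (η y.1) 0) (inl A) (inr i) z
      = 0 := by
  simp [covDerivComp, christoffel_warped_inl_inl_inr b c h, pderiv_const]

theorem covDerivComp_warped_inr_inl (h : WarpedRegular g ρ Ω z) (η : E → ι → ℝ) (A : ι) (i : κ) :
    covDerivComp (b.prod c) (warped g ρ Ω) (fun y => Sum.elim (η y.1) 0) (inr i) (inl A) z
      = 0 := by
  simp [covDerivComp, christoffel_warped_inl_inr_inl b c h,
    pderiv_comp_fst_inr b c (fun x => η x A)]

/-- For a covector field `η` that is pulled back from the base, the fibre components of the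
covariant derivative are proportional to `η(grad ρ)`. -/
theorem covDerivComp_warped_inr_inr (h : WarpedRegular g ρ Ω z) (η : E → ι → ℝ) (i j : κ) :
    covDerivComp (b.prod c) (warped g ρ Ω) (fun y => Sum.elim (η y.1) 0) (inr i) (inr j) z
      = ρ z.1 * Ω z.2 i j * ∑ C, (∑ D, (g z.1)⁻¹ C D * pderiv b ρ D z.1) * η z.1 C := by
  simp only [covDerivComp, christoffel_warped_inl_inr_inr b c h, pderiv_const, Sum.elim_inr,
    Sum.elim_inl, Fintype.sum_sum_type, Pi.zero_apply, mul_zero, Finset.sum_const_zero, add_zero,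
    zero_sub, ← Finset.sum_neg_distrib]
  rw [Finset.mul_sum]
  exact Finset.sum_congr rfl fun C _ => by ring

end Warped

/-! ### Two-dimensional metrics -/

section TwoDim

variable {E : Type*} [NormedAddCommGroup E] [NormedSpace ℝ E] (b : Module.Basis (Fin 2) ℝ E)

/-- Both sides vanish when `g` is singular. -/
theorem inv_two (g : Matrix (Fin 2) (Fin 2) ℝ) :
    g⁻¹ = !![g.det⁻¹ * g 1 1, - (g.det⁻¹ * g 0 1); - (g.det⁻¹ * g 1 0), g.det⁻¹ * g 0 0] := by
  rw [Matrix.inv_def, Matrix.adjugate_fin_two, Ring.inverse_eq_inv']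
  ext i j
  fin_cases i <;> fin_cases j <;> simp

theorem christoffel_two (γ : E → Matrix (Fin 2) (Fin 2) ℝ) (k i j : Fin 2) :
    christoffel b γ k i j = fun x => (1 / 2) * ((γ x)⁻¹ k 0 *
      (pderiv b (fun y => γ y 0 j) i x + pderiv b (fun y => γ y 0 i) j x
      - pderiv b (fun y => γ y i j) 0 x) + (γ x)⁻¹ k 1 *
      (pderiv b (fun y => γ y 1 j) i x + pderiv b (fun y => γ y 1 i) j x
      - pderiv b (fun y => γ y i j) 1 x)) := by
  funext x
  simp [christoffel, Fin.sum_univ_two]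

/-- The metric with components `p, q, q, r`. -/
def symMatrix {X : Type*} (p q r : X → ℝ) (x : X) : Matrix (Fin 2) (Fin 2) ℝ :=
  !![p x, q x; q x, r x]

variable {p q r : E → ℝ} {x : E}

theorem det_symMatrix {X : Type*} {p q r : X → ℝ} (y : X) :
    (symMatrix p q r y).det = p y * r y - q y * q y := by
  simp [symMatrix, Matrix.det_fin_two]

theorem pderiv_inv_mul {f h : E → ℝ} {x : E} (hf : DifferentiableAt ℝ f x)
    (hh : DifferentiableAt ℝ h x) (h0 : f x ≠ 0) (i : Fin 2) :
    pderiv b (fun y => (f y)⁻¹ * h y) i x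
      = - pderiv b f i x / f x ^ 2 * h x + (f x)⁻¹ * pderiv b h i x := by
  rw [pderiv_mul b (hf.fun_inv h0) hh, pderiv_inv b hf h0]

theorem pderiv_half {f : E → ℝ} {x : E} (hf : DifferentiableAt ℝ f x) (i : Fin 2) :
    pderiv b (fun y => (1 / 2) * f y) i x = (1 / 2) * pderiv b f i x := by
  rw [pderiv_mul b (differentiableAt_const _) hf, pderiv_const]; ring

/-- The Christoffel symbols of the first kind, `Γ_{lij} = ½ (∂_i g_{lj} + ∂_j g_{li} - ∂_l g_{ij})`. -/
def christoffelFirst (γ : E → Matrix (Fin 2) (Fin 2) ℝ) (l i j : Fin 2) (x : E) : ℝ :=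
  (1 / 2) * (pderiv b (fun y => γ y l j) i x + pderiv b (fun y => γ y l i) j x
    - pderiv b (fun y => γ y i j) l x)

theorem contDiffAt_symMatrix (hp : ContDiffAt ℝ ∞ p x) (hq : ContDiffAt ℝ ∞ q x)
    (hr : ContDiffAt ℝ ∞ r x) (i j : Fin 2) :
    ContDiffAt ℝ ∞ (fun y => symMatrix p q r y i j) x := by
  fin_cases i <;> fin_cases j <;> simpa [symMatrix]

/-- Explicit form of the proportionality of Ricci tensor and metric in two dimensions: once the
Christoffel symbols and their derivatives are written in terms of `p`, `q`, `r` and their partial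
derivatives, each component is an identity of rational functions. -/
theorem ricciComp_symMatrix (hp : ContDiffAt ℝ ∞ p x) (hq : ContDiffAt ℝ ∞ q x)
    (hr : ContDiffAt ℝ ∞ r x) (hdet : p x * r x - q x * q x ≠ 0) :
    ∃ c : ℝ, ∀ i j, ricciComp b (symMatrix p q r) i j x = c * symMatrix p q r x i j := by
  have hg := contDiffAt_symMatrix hp hq hr
  have dp := hp.differentiableAt (by simp)
  have dq := hq.differentiableAt (by simp)
  have dr := hr.differentiableAt (by simp)
  have dd : ∀ {f : E → ℝ}, ContDiffAt ℝ ∞ f x → ∀ i, DifferentiableAt ℝ (pderiv b f i) x :=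
    fun hf i => (pderiv_contDiffAt b hf i).differentiableAt (by simp)
  have dD : DifferentiableAt ℝ (fun y => p y * r y - q y * q y) x :=
    (dp.fun_mul dr).fun_sub (dq.fun_mul dq)
  have eD : ∀ m, pderiv b (fun y => p y * r y - q y * q y) m x
      = pderiv b p m x * r x + p x * pderiv b r m x - 2 * q x * pderiv b q m x := by
    intro m
    rw [pderiv_sub b (dp.fun_mul dr) (dq.fun_mul dq), pderiv_mul b dp dr, pderiv_mul b dq dq]
    ring
  have dL : ∀ l i j, DifferentiableAt ℝ (christoffelFirst b (symMatrix p q r) l i j) x :=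
    fun l i j => ((((dd (hg l j) i).fun_add (dd (hg l i) j)).fun_sub
      (dd (hg i j) l)).const_mul (1 / 2))
  have eL : ∀ l i j m, pderiv b (christoffelFirst b (symMatrix p q r) l i j) m x
      = (1 / 2) * (pderiv b (pderiv b (fun y => symMatrix p q r y l j) i) m x
        + pderiv b (pderiv b (fun y => symMatrix p q r y l i) j) m x
        - pderiv b (pderiv b (fun y => symMatrix p q r y i j) l) m x) := by
    intro l i j m
    rw [← pderiv_add b (dd (hg l j) i) (dd (hg l i) j),
      ← pderiv_sub b ((dd (hg l j) i).fun_add (dd (hg l i) j)) (dd (hg i j) l),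
      ← pderiv_half b (((dd (hg l j) i).fun_add (dd (hg l i) j)).fun_sub (dd (hg i j) l))]
    rfl
  -- Every Christoffel symbol is `(det g)⁻¹ (u v - u' v')` with `u, u'` among the components of `g`
  -- and `v, v'` Christoffel symbols of the first kind.
  have key : ∀ (u v u' v' : E → ℝ), DifferentiableAt ℝ u x → DifferentiableAt ℝ v x →
      DifferentiableAt ℝ u' x → DifferentiableAt ℝ v' x → ∀ m,
      pderiv b (fun y => (p y * r y - q y * q y)⁻¹ * (u y * v y - u' y * v' y)) m x
        = - (pderiv b p m x * r x + p x * pderiv b r m x - 2 * q x * pderiv b q m x)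
            / (p x * r x - q x * q x) ^ 2 * (u x * v x - u' x * v' x)
          + (p x * r x - q x * q x)⁻¹ * (pderiv b u m x * v x + u x * pderiv b v m x
            - (pderiv b u' m x * v' x + u' x * pderiv b v' m x)) := by
    intro u v u' v' hu hv hu' hv' m
    rw [pderiv_inv_mul b dD ((hu.fun_mul hv).fun_sub (hu'.fun_mul hv')) hdet, eD,
      pderiv_sub b (hu.fun_mul hv) (hu'.fun_mul hv'), pderiv_mul b hu hv, pderiv_mul b hu' hv']
  have c0 : ∀ i j, christoffel b (symMatrix p q r) 0 i j = fun y =>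
      (p y * r y - q y * q y)⁻¹ * (r y * christoffelFirst b (symMatrix p q r) 0 i j y
        - q y * christoffelFirst b (symMatrix p q r) 1 i j y) := by
    intro i j
    funext y
    have e0 : (symMatrix p q r y)⁻¹ 0 0 = (p y * r y - q y * q y)⁻¹ * r y := by
      rw [inv_two, det_symMatrix]; simp [symMatrix]
    have e1 : (symMatrix p q r y)⁻¹ 0 1 = - ((p y * r y - q y * q y)⁻¹ * q y) := by
      rw [inv_two, det_symMatrix]; simp [symMatrix]
    simp only [christoffel_two, christoffelFirst, e0, e1]
    ring
  have c1 : ∀ i j, christoffel b (symMatrix p q r) 1 i j = fun y =>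
      (p y * r y - q y * q y)⁻¹ * (p y * christoffelFirst b (symMatrix p q r) 1 i j y
        - q y * christoffelFirst b (symMatrix p q r) 0 i j y) := by
    intro i j
    funext y
    have e0 : (symMatrix p q r y)⁻¹ 1 1 = (p y * r y - q y * q y)⁻¹ * p y := by
      rw [inv_two, det_symMatrix]; simp [symMatrix]
    have e1 : (symMatrix p q r y)⁻¹ 1 0 = - ((p y * r y - q y * q y)⁻¹ * q y) := by
      rw [inv_two, det_symMatrix]; simp [symMatrix]
    simp only [christoffel_two, christoffelFirst, e0, e1]
    ring
  have c0' : ∀ i j m, pderiv b (christoffel b (symMatrix p q r) 0 i j) m x = _ := fun i j m =>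
    (congrArg (fun f => pderiv b f m x) (c0 i j)).trans (key _ _ _ _ dr (dL 0 i j) dq (dL 1 i j) m)
  have c1' : ∀ i j m, pderiv b (christoffel b (symMatrix p q r) 1 i j) m x = _ := fun i j m =>
    (congrArg (fun f => pderiv b f m x) (c1 i j)).trans (key _ _ _ _ dp (dL 1 i j) dq (dL 0 i j) m)
  have s00 : (fun y => symMatrix p q r y 0 0) = p := by funext y; simp [symMatrix]
  have s01 : (fun y => symMatrix p q r y 0 1) = q := by funext y; simp [symMatrix]
  have s10 : (fun y => symMatrix p q r y 1 0) = q := by funext y; simp [symMatrix]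
  have s11 : (fun y => symMatrix p q r y 1 1) = r := by funext y; simp [symMatrix]
  have t00 : symMatrix p q r x 0 0 = p x := congrFun s00 x
  have t01 : symMatrix p q r x 0 1 = q x := congrFun s01 x
  have t10 : symMatrix p q r x 1 0 = q x := congrFun s10 x
  have t11 : symMatrix p q r x 1 1 = r x := congrFun s11 x
  -- The factor is `R_{0101} / det g`, the Gaussian curvature.
  refine ⟨(p x * r x - q x * q x)⁻¹ * ((1 / 2) * (2 * pderiv b (pderiv b q 0) 1 x
    - pderiv b (pderiv b p 1) 1 x - pderiv b (pderiv b r 0) 0 x)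
    + (p x * r x - q x * q x)⁻¹ * (r x * ((1 / 4) * (pderiv b p 1 x * pderiv b p 1 x
        - pderiv b p 0 x * (2 * pderiv b q 1 x - pderiv b r 0 x)))
      - q x * ((1 / 4) * (2 * pderiv b p 1 x * pderiv b r 0 x - pderiv b p 0 x * pderiv b r 1 x
        - (2 * pderiv b q 0 x - pderiv b p 1 x) * (2 * pderiv b q 1 x - pderiv b r 0 x)))
      + p x * ((1 / 4) * (pderiv b r 0 x * pderiv b r 0 x
        - (2 * pderiv b q 0 x - pderiv b p 1 x) * pderiv b r 1 x)))), ?_⟩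
  rw [Fin.forall_fin_two, Fin.forall_fin_two, Fin.forall_fin_two]
  simp only [ricciComp, Fin.sum_univ_two, c0', c1', eL]
  simp only [c0, c1, christoffelFirst, s00, s01, s10, s11, t00, t01, t10, t11, pderiv_comm b hp 1 0,
    pderiv_comm b hq 1 0, pderiv_comm b hr 1 0]
  generalize pderiv b (pderiv b p 0) 0 x = P00
  generalize pderiv b (pderiv b p 0) 1 x = P01
  generalize pderiv b (pderiv b p 1) 1 x = P11
  generalize pderiv b (pderiv b q 0) 0 x = Q00
  generalize pderiv b (pderiv b q 0) 1 x = Q01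
  generalize pderiv b (pderiv b q 1) 1 x = Q11
  generalize pderiv b (pderiv b r 0) 0 x = R00
  generalize pderiv b (pderiv b r 0) 1 x = R01
  generalize pderiv b (pderiv b r 1) 1 x = R11
  generalize pderiv b p 0 x = P0
  generalize pderiv b p 1 x = P1
  generalize pderiv b q 0 x = Q0
  generalize pderiv b q 1 x = Q1
  generalize pderiv b r 0 x = R0
  generalize pderiv b r 1 x = R1
  revert hdet
  generalize p x = p
  generalize q x = q
  generalize r x = r
  intro hdet
  -- The determinant is kept as an atom, so that `field_simp` clears its powers.
  obtain ⟨D, hD⟩ : ∃ D, D = p * r - q * q := ⟨_, rfl⟩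
  rw [← hD] at hdet
  simp only [← hD]
  refine ⟨⟨?_, ?_⟩, ?_, ?_⟩
  · field_simp
    rw [hD]
    ring
  · field_simp
    rw [hD]
    ring
  · field_simp
    rw [hD]
    ring
  · field_simp
    rw [hD]
    ring

/-- In two dimensions the Ricci tensor is proportional to the metric. -/
theorem exists_ricciComp_eq {g : E → Matrix (Fin 2) (Fin 2) ℝ}
    (hg : ∀ i j, ContDiffAt ℝ ∞ (fun y => g y i j) x) (hs : ∀ᶠ y in 𝓝 x, g y 1 0 = g y 0 1)
    (hdet : (g x).det ≠ 0) : ∃ c : ℝ, ∀ i j, ricciComp b g i j x = c * g x i j := by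
  have e : g =ᶠ[𝓝 x] symMatrix (fun y => g y 0 0) (fun y => g y 0 1) (fun y => g y 1 1) := by
    filter_upwards [hs] with y hy
    ext i j
    fin_cases i <;> fin_cases j <;> simp [symMatrix, hy]
  have hd : g x 0 0 * g x 1 1 - g x 0 1 * g x 0 1 ≠ 0 := by
    rwa [Matrix.det_fin_two, hs.self_of_nhds] at hdet
  obtain ⟨c, hc⟩ := ricciComp_symMatrix b (hg 0 0) (hg 0 1) (hg 1 1) hd
  refine ⟨c, fun i j => ?_⟩
  rw [ricciComp_congr b e, hc, e.self_of_nhds]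

/-- The components `(grad ρ)^C = g^{CD} ∂_D ρ`. -/
def gradComp {ι : Type*} [Fintype ι] [DecidableEq ι] (b : Module.Basis ι ℝ E)
    (γ : E → Matrix ι ι ℝ) (f : E → ℝ) (x : E) (C : ι) : ℝ :=
  ∑ D, (γ x)⁻¹ C D * pderiv b f D x

/-- The covariant components `(grad ρ)^C ε_{CB}` of the Kodama vector. -/
def kodamaComp (g ε : E → Matrix (Fin 2) (Fin 2) ℝ) (ρ : E → ℝ) (x : E) (B : Fin 2) : ℝ :=
  ∑ C, gradComp b g ρ x C * ε x C B

/-- The antisymmetric form with component `ε_{01} = e`. -/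
def skewMatrix {X : Type*} (e : X → ℝ) (x : X) : Matrix (Fin 2) (Fin 2) ℝ :=
  !![0, e x; - e x, 0]

/-- Explicit form of `symCovDeriv_kodamaComp`. With `det g = -e²` the inverse metric is `-e⁻²` times
the adjugate, so that `K_0 = (p ∂_1ρ - q ∂_0ρ) / e` and `K_1 = (q ∂_1ρ - r ∂_0ρ) / e`; the derivatives
of `e` follow from those of `e² = -det g`. -/
theorem symCovDeriv_kodamaComp_symMatrix {ρ e : E → ℝ} (hp : ContDiffAt ℝ ∞ p x)
    (hq : ContDiffAt ℝ ∞ q x) (hr : ContDiffAt ℝ ∞ r x) (hρ : ContDiffAt ℝ ∞ ρ x)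
    (he : ContDiffAt ℝ ∞ e x) (h0 : e x ≠ 0)
    (hdet : ∀ᶠ y in 𝓝 x, e y * e y = - (p y * r y - q y * q y)) (A B : Fin 2) :
    (1 / 2) * (covDerivComp b (symMatrix p q r)
          (kodamaComp b (symMatrix p q r) (skewMatrix e) ρ) A B x
        + covDerivComp b (symMatrix p q r)
          (kodamaComp b (symMatrix p q r) (skewMatrix e) ρ) B A x)
      = - ∑ C, ∑ D, skewMatrix e x A D * (symMatrix p q r x)⁻¹ C D *
        (hessComp b (symMatrix p q r) ρ C B x - (1 / 2) * (∑ C', ∑ D',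
          (symMatrix p q r x)⁻¹ C' D' * hessComp b (symMatrix p q r) ρ C' D' x)
          * symMatrix p q r x C B) := by
  have dp := hp.differentiableAt (by simp)
  have dq := hq.differentiableAt (by simp)
  have dr := hr.differentiableAt (by simp)
  have de := he.differentiableAt (by simp)
  have dd : ∀ i, DifferentiableAt ℝ (pderiv b ρ i) x :=
    fun i => (pderiv_contDiffAt b hρ i).differentiableAt (by simp)
  -- Differentiate `e² = -det g`.
  have ee : ∀ m, pderiv b e m x = (2 * q x * pderiv b q m x - pderiv b p m x * r x
      - p x * pderiv b r m x) / (2 * e x) := by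
    intro m
    have := pderiv_congr b hdet m
    rw [pderiv_mul b de de, pderiv_neg, pderiv_sub b (dp.fun_mul dr) (dq.fun_mul dq),
      pderiv_mul b dp dr, pderiv_mul b dq dq] at this
    field_simp
    linarith
  have hinv : ∀ y, e y * e y = - (p y * r y - q y * q y) → (symMatrix p q r y)⁻¹
      = !![- (r y / e y ^ 2), q y / e y ^ 2; q y / e y ^ 2, - (p y / e y ^ 2)] := by
    intro y hy
    have : p y * r y - q y * q y = - e y ^ 2 := by linarith [hy]
    rw [inv_two, det_symMatrix, this]
    ext i j
    fin_cases i <;> fin_cases j <;> simp [symMatrix, inv_neg] <;> ring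
  have h0' : ∀ᶠ y in 𝓝 x, e y ≠ 0 := he.continuousAt.eventually_ne h0
  have k0 : (fun y => kodamaComp b (symMatrix p q r) (skewMatrix e) ρ y 0) =ᶠ[𝓝 x]
      fun y => (e y)⁻¹ * (p y * pderiv b ρ 1 y - q y * pderiv b ρ 0 y) := by
    filter_upwards [hdet, h0'] with y hy hy0
    simp [kodamaComp, gradComp, hinv y hy, skewMatrix, Fin.sum_univ_two]
    field_simp
    ring
  have k1 : (fun y => kodamaComp b (symMatrix p q r) (skewMatrix e) ρ y 1) =ᶠ[𝓝 x]
      fun y => (e y)⁻¹ * (q y * pderiv b ρ 1 y - r y * pderiv b ρ 0 y) := by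
    filter_upwards [hdet, h0'] with y hy hy0
    simp [kodamaComp, gradComp, hinv y hy, skewMatrix, Fin.sum_univ_two]
    field_simp
    ring
  have key : ∀ u v : E → ℝ, DifferentiableAt ℝ u x → DifferentiableAt ℝ v x → ∀ m,
      pderiv b (fun y => (e y)⁻¹ * (u y * pderiv b ρ 1 y - v y * pderiv b ρ 0 y)) m x
        = - pderiv b e m x / e x ^ 2 * (u x * pderiv b ρ 1 x - v x * pderiv b ρ 0 x)
          + (e x)⁻¹ * (pderiv b u m x * pderiv b ρ 1 x + u x * pderiv b (pderiv b ρ 1) m x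
            - (pderiv b v m x * pderiv b ρ 0 x + v x * pderiv b (pderiv b ρ 0) m x)) := by
    intro u v hu hv m
    rw [pderiv_inv_mul b de ((hu.fun_mul (dd 1)).fun_sub (hv.fun_mul (dd 0))) h0,
      pderiv_sub b (hu.fun_mul (dd 1)) (hv.fun_mul (dd 0)), pderiv_mul b hu (dd 1),
      pderiv_mul b hv (dd 0)]
  have k0' : ∀ m, pderiv b (fun y => kodamaComp b (symMatrix p q r) (skewMatrix e) ρ y 0) m x = _ :=
    fun m => (pderiv_congr b k0 m).trans (key p q dp dq m)
  have k1' : ∀ m, pderiv b (fun y => kodamaComp b (symMatrix p q r) (skewMatrix e) ρ y 1) m x = _ :=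
    fun m => (pderiv_congr b k1 m).trans (key q r dq dr m)
  have k0x := k0.self_of_nhds
  have k1x := k1.self_of_nhds
  simp only at k0x k1x
  have s00 : (fun y => symMatrix p q r y 0 0) = p := by funext y; simp [symMatrix]
  have s01 : (fun y => symMatrix p q r y 0 1) = q := by funext y; simp [symMatrix]
  have s10 : (fun y => symMatrix p q r y 1 0) = q := by funext y; simp [symMatrix]
  have s11 : (fun y => symMatrix p q r y 1 1) = r := by funext y; simp [symMatrix]
  have t00 : symMatrix p q r x 0 0 = p x := congrFun s00 x
  have t01 : symMatrix p q r x 0 1 = q x := congrFun s01 x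
  have t10 : symMatrix p q r x 1 0 = q x := congrFun s10 x
  have t11 : symMatrix p q r x 1 1 = r x := congrFun s11 x
  have hi := hinv x hdet.self_of_nhds
  have i00 : (symMatrix p q r x)⁻¹ 0 0 = - (r x / e x ^ 2) := by rw [hi]; simp
  have i01 : (symMatrix p q r x)⁻¹ 0 1 = q x / e x ^ 2 := by rw [hi]; simp
  have i10 : (symMatrix p q r x)⁻¹ 1 0 = q x / e x ^ 2 := by rw [hi]; simp
  have i11 : (symMatrix p q r x)⁻¹ 1 1 = - (p x / e x ^ 2) := by rw [hi]; simp
  have e00 : skewMatrix e x 0 0 = 0 := by simp [skewMatrix]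
  have e01 : skewMatrix e x 0 1 = e x := by simp [skewMatrix]
  have e10 : skewMatrix e x 1 0 = - e x := by simp [skewMatrix]
  have e11 : skewMatrix e x 1 1 = 0 := by simp [skewMatrix]
  have hdx := hdet.self_of_nhds
  revert A B
  rw [Fin.forall_fin_two, Fin.forall_fin_two, Fin.forall_fin_two]
  simp only [covDerivComp, hessComp, Fin.sum_univ_two, k0', k1', k0x, k1x, christoffel_two,
    s00, s01, s10, s11, t00, t01, t10, t11, i00, i01, i10, i11, e00, e01, e10, e11, ee,
    pderiv_comm b hρ 1 0]
  clear k0' k1' k0x k1x key k0 k1 hinv hi ee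
  generalize pderiv b (pderiv b ρ 0) 0 x = F00
  generalize pderiv b (pderiv b ρ 0) 1 x = F01
  generalize pderiv b (pderiv b ρ 1) 1 x = F11
  generalize pderiv b ρ 0 x = F0
  generalize pderiv b ρ 1 x = F1
  generalize pderiv b p 0 x = P0
  generalize pderiv b p 1 x = P1
  generalize pderiv b q 0 x = Q0
  generalize pderiv b q 1 x = Q1
  generalize pderiv b r 0 x = R0
  generalize pderiv b r 1 x = R1
  revert h0 hdx
  clear * -
  generalize p x = p
  generalize q x = q
  generalize r x = r
  generalize e x = e
  intro h0 hdx
  -- After clearing `e`, the four identities hold modulo `e² = -det g`, which is `hdx`.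
  refine ⟨⟨?_, ?_⟩, ?_, ?_⟩
  · field_simp
    grind
  · field_simp
    grind
  · field_simp
    grind
  · field_simp
    grind

/-- The Kodama vector is orthogonal to the gradient of `ρ`. -/
theorem sum_gradComp_mul_kodamaComp {g ε : E → Matrix (Fin 2) (Fin 2) ℝ} {ρ : E → ℝ}
    (ha : ∀ A B, ε x A B = - ε x B A) :
    ∑ C, gradComp b g ρ x C * kodamaComp b g ε ρ x C = 0 := by
  have h0 := ha 0 0
  have h1 := ha 1 1
  have h2 := ha 0 1
  simp only [kodamaComp, Fin.sum_univ_two]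
  rw [h2, show ε x 0 0 = 0 by linarith, show ε x 1 1 = 0 by linarith]
  ring

/-- In two dimensions `∇_{(A} K_{B)} = -ε_A{}^C (∇_C ∂_B ρ - ½ (∇^D ∂_D ρ) g_{CB})` for the Kodama
vector `K_B = (grad ρ)^C ε_{CB}`. -/
theorem symCovDeriv_kodamaComp {g ε : E → Matrix (Fin 2) (Fin 2) ℝ} {ρ : E → ℝ}
    (hg : ∀ i j, ContDiffAt ℝ ∞ (fun y => g y i j) x) (hs : ∀ᶠ y in 𝓝 x, g y 1 0 = g y 0 1)
    (hdet : (g x).det ≠ 0) (hρ : ContDiffAt ℝ ∞ ρ x)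
    (hε : ContDiffAt ℝ ∞ (fun y => ε y 0 1) x) (ha : ∀ᶠ y in 𝓝 x, ∀ A B, ε y A B = - ε y B A)
    (hn : ∀ᶠ y in 𝓝 x, ε y 0 1 ^ 2 = - (g y).det) (A B : Fin 2) :
    (1 / 2) * (covDerivComp b g (kodamaComp b g ε ρ) A B x
        + covDerivComp b g (kodamaComp b g ε ρ) B A x)
      = - ∑ C, ∑ D, ε x A D * (g x)⁻¹ C D * (hessComp b g ρ C B x
        - (1 / 2) * (∑ C', ∑ D', (g x)⁻¹ C' D' * hessComp b g ρ C' D' x) * g x C B) := by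
  have e : g =ᶠ[𝓝 x] symMatrix (fun y => g y 0 0) (fun y => g y 0 1) (fun y => g y 1 1) := by
    filter_upwards [hs] with y hy
    ext i j
    fin_cases i <;> fin_cases j <;> simp [symMatrix, hy]
  have e' : ε =ᶠ[𝓝 x] skewMatrix (fun y => ε y 0 1) := by
    filter_upwards [ha] with y hy
    have h0 := hy 0 0
    have h1 := hy 1 1
    ext i j
    fin_cases i <;> fin_cases j <;> simp [skewMatrix] <;> linarith [hy 1 0]
  have eK : kodamaComp b g ε ρ =ᶠ[𝓝 x] kodamaComp b
      (symMatrix (fun y => g y 0 0) (fun y => g y 0 1) (fun y => g y 1 1))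
      (skewMatrix (fun y => ε y 0 1)) ρ := by
    filter_upwards [e, e'] with y hy hy'
    funext C
    simp only [kodamaComp, gradComp, hy, hy']
  have eH : ∀ C D, hessComp b g ρ C D x = hessComp b
      (symMatrix (fun y => g y 0 0) (fun y => g y 0 1) (fun y => g y 1 1)) ρ C D x := by
    intro C D
    simp only [hessComp, (christoffel_eventuallyEq b e _ _ _).self_of_nhds]
  have h0 : ε x 0 1 ≠ 0 := by
    intro h
    have := hn.self_of_nhds
    rw [h] at this
    exact hdet (by linarith)
  have hn' : ∀ᶠ y in 𝓝 x, ε y 0 1 * ε y 0 1 = - (g y 0 0 * g y 1 1 - g y 0 1 * g y 0 1) := by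
    filter_upwards [hn, hs] with y hy hys
    rw [Matrix.det_fin_two, hys] at hy
    linarith
  rw [covDerivComp_congr b e eK, covDerivComp_congr b e eK,
    symCovDeriv_kodamaComp_symMatrix b (hg 0 0) (hg 0 1) (hg 1 1) hρ hε h0 hn']
  simp only [eH, e.self_of_nhds, e'.self_of_nhds]

end TwoDim

/-! ### Bilinear forms in a basis -/

section LinearAlgebra

variable {V : Type*} [AddCommGroup V] [Module ℝ V] [TopologicalSpace V]
  {ι : Type*} [Fintype ι]

theorem form_sum_smul (B : V →L[ℝ] V →L[ℝ] ℝ) (F : ι → V) (a c : ι → ℝ) :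
    B (∑ i, a i • F i) (∑ j, c j • F j) = ∑ i, ∑ j, a i * c j * B (F i) (F j) := by
  rw [map_sum B, FunLike.coe_sum, Finset.sum_apply]
  refine Finset.sum_congr rfl fun i _ => ?_
  rw [map_sum]
  refine Finset.sum_congr rfl fun j _ => ?_
  simp [mul_left_comm, mul_assoc]

variable [DecidableEq ι]

/-- The Gram matrix of a nondegenerate form is invertible. -/
theorem det_gram_ne_zero (F : Module.Basis ι ℝ V) (B : V →L[ℝ] V →L[ℝ] ℝ)
    (hB : ∀ v, (∀ w, B v w = 0) → v = 0) : (Matrix.of fun i j => B (F i) (F j)).det ≠ 0 := by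
  intro h
  obtain ⟨c, hc, hc0⟩ := Matrix.exists_vecMul_eq_zero_iff.2 h
  refine hc ?_
  have h1 : ∑ i, c i • F i = 0 := by
    refine hB _ fun w => ?_
    have h2 : ∀ j, B (∑ i, c i • F i) (F j) = 0 := by
      intro j
      have := congrFun hc0 j
      simpa [Matrix.vecMul, dotProduct] using this
    rw [← F.sum_repr w, map_sum]
    exact Finset.sum_eq_zero fun j _ => by rw [map_smul, h2, smul_zero]
  funext i
  exact (Fintype.linearIndependent_iff.1 F.linearIndependent) c h1 i

variable [IsTopologicalAddGroup V] [ContinuousSMul ℝ V]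

/-- A symmetric form with invertible Gram matrix `g` is invertible, and its inverse raises an index
with `g⁻¹`. -/
theorem isInvertible_form (F : Module.Basis ι ℝ V) (B : V →L[ℝ] V →L[ℝ] ℝ)
    (hs : ∀ v w, B v w = B w v) (g : Matrix ι ι ℝ) (hg : ∀ i j, g i j = B (F i) (F j))
    (hd : g.det ≠ 0) :
    B.IsInvertible ∧
      ∀ η : V →L[ℝ] ℝ, B.inverse η = ∑ C, (∑ D, g⁻¹ C D * η (F D)) • F C := by
  have hu : IsUnit g.det := hd.isUnit
  let ev : V → (V →L[ℝ] ℝ) →L[ℝ] ℝ := fun v =>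
    { toFun := fun η => η v
      map_add' := fun _ _ => rfl
      map_smul' := fun _ _ => rfl
      cont := continuous_eval_const v }
  have hev : ∀ v η, ev v η = η v := fun _ _ => rfl
  let R : (V →L[ℝ] ℝ) →L[ℝ] V := ∑ C, ∑ D,
    g⁻¹ C D • (ev (F D)).smulRight (F C)
  have hR : ∀ η, R η = ∑ C, (∑ D, g⁻¹ C D * η (F D)) • F C := by
    intro η
    simp [R, Finset.sum_smul, mul_smul, hev]
  have h1 : R.comp B = ContinuousLinearMap.id ℝ V := by
    have : ∀ i, R (B (F i)) = F i := by
      intro i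
      rw [hR]
      have e : ∀ C, ∑ D, g⁻¹ C D * B (F i) (F D) = if C = i then 1 else 0 := by
        intro C
        have := congrFun (congrFun (Matrix.nonsing_inv_mul g hu) C) i
        rw [Matrix.mul_apply, Matrix.one_apply] at this
        rw [← this]
        exact Finset.sum_congr rfl fun D _ => by rw [hg, hs]
      simp [e]
    refine ContinuousLinearMap.coe_injective (F.ext fun i => ?_)
    simpa using this i
  have h2 : B.comp R = ContinuousLinearMap.id ℝ (V →L[ℝ] ℝ) := by
    refine ContinuousLinearMap.ext fun η => ContinuousLinearMap.coe_injective (F.ext fun i => ?_)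
    have e : ∀ D, ∑ C, g⁻¹ C D * B (F C) (F i) = if i = D then 1 else 0 := by
      intro D
      have := congrFun (congrFun (Matrix.mul_nonsing_inv g hu) i) D
      rw [Matrix.mul_apply, Matrix.one_apply] at this
      rw [← this]
      exact Finset.sum_congr rfl fun C _ => by rw [hg, hs, mul_comm]
    calc B (R η) (F i) = ∑ C, (∑ D, g⁻¹ C D * η (F D)) * B (F C) (F i) := by
          rw [hR]; simp [map_sum]
      _ = ∑ D, (∑ C, g⁻¹ C D * B (F C) (F i)) * η (F D) := by
          simp only [Finset.sum_mul]
          rw [Finset.sum_comm]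
          exact Finset.sum_congr rfl fun D _ => Finset.sum_congr rfl fun C _ => by ring
      _ = η (F i) := by simp [e]
  exact ⟨.of_inverse h2 h1, fun η => by rw [ContinuousLinearMap.inverse_eq h2 h1, hR]⟩

end LinearAlgebra

/-! ### Tensor fields in a chart -/

section Charts

variable {E : Type*} [NormedAddCommGroup E] [NormedSpace ℝ E]
  {H : Type*} [TopologicalSpace H] {I : ModelWithCorners ℝ E H}
  {M : Type*} [TopologicalSpace M] [ChartedSpace H M] [IsManifold I ∞ M]
  {ι : Type*} (b : Module.Basis ι ℝ E)

variable (I) in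
/-- The basis `b` of the model space as a basis of the tangent space at `p`. Since the tangent space
is identified with the model space by the preferred chart at `p`, these are the coordinate vectors
of this chart at its base point. -/
def tangentBasis (p : M) : Module.Basis ι ℝ (TangentSpace I p) := b

/-- The preferred chart at `p` induces the identity on the tangent space at `p`. -/
theorem coordComp_self (p : M) (v : TangentSpace I p) (i : ι) :
    coordComp I b p v i = (tangentBasis I b p).repr v i := by
  have : IsManifold I 1 M := IsManifold.of_le (n := ∞) (by simp)
  rw [coordComp, mfderiv_extChartAt_self]
  rfl

variable [I.Boundaryless]

theorem contMDiffAt_extChartAt_symm {p : M} {x : E} (hx : x ∈ (extChartAt I p).target) :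
    ContMDiffAt 𝓘(ℝ, E) I ∞ (extChartAt I p).symm x :=
  (contMDiffOn_extChartAt_symm p).contMDiffAt ((isOpen_extChartAt_target p).mem_nhds hx)

theorem mdifferentiableAt_extChartAt_symm {p : M} {x : E} (hx : x ∈ (extChartAt I p).target) :
    MDifferentiableAt 𝓘(ℝ, E) I (extChartAt I p).symm x :=
  (contMDiffAt_extChartAt_symm hx).mdifferentiableAt (by simp)

theorem isInvertible_mfderiv_extChartAt_symm {p : M} {x : E} (hx : x ∈ (extChartAt I p).target) :
    (mfderiv 𝓘(ℝ, E) I (extChartAt I p).symm x).IsInvertible := by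
  have : IsManifold I 1 M := IsManifold.of_le (n := ∞) (by simp)
  have := isInvertible_mfderivWithin_extChartAt_symm hx
  rwa [I.range_eq_univ, mfderivWithin_univ] at this

/-- The coordinate vector fields of a chart form a basis of the tangent space. -/
theorem exists_basis_coordVec {p : M} {x : E} (hx : x ∈ (extChartAt I p).target) :
    ∃ F : Module.Basis ι ℝ (TangentSpace I ((extChartAt I p).symm x)),
      ∀ i, F i = coordVec I b p x i := by
  obtain ⟨e, he⟩ := isInvertible_mfderiv_extChartAt_symm hx
  refine ⟨b.map e.toLinearEquiv, fun i => ?_⟩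
  simp only [coordVec, ← he]
  rfl

theorem mfderiv_coordVec {f : M → ℝ} {p : M} {x : E} (hx : x ∈ (extChartAt I p).target)
    (hf : MDifferentiableAt I 𝓘(ℝ, ℝ) f ((extChartAt I p).symm x)) (i : ι) :
    mfderiv I 𝓘(ℝ, ℝ) f ((extChartAt I p).symm x) (coordVec I b p x i)
      = pderiv b (fun y => f ((extChartAt I p).symm y)) i x := by
  have h := mfderiv_comp x hf (mdifferentiableAt_extChartAt_symm hx)
  rw [mfderiv_eq_fderiv] at h
  exact (congrArg (fun A : E →L[ℝ] ℝ => A (b i)) h).symm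

theorem contDiffAt_comp_extChartAt_symm {f : M → ℝ} (hf : ContMDiff I 𝓘(ℝ, ℝ) ∞ f) {p : M} {x : E}
    (hx : x ∈ (extChartAt I p).target) :
    ContDiffAt ℝ ∞ (fun y => f ((extChartAt I p).symm y)) x :=
  contMDiffAt_iff_contDiffAt.1 (hf.contMDiffAt.comp x (contMDiffAt_extChartAt_symm hx))

/-- The coordinate vector fields are smooth, as the images of constant vector fields under the tangent
map of the inverse chart. -/
theorem contMDiffAt_coordVec {p : M} {x : E} (hx : x ∈ (extChartAt I p).target) (i : ι) :
    ContMDiffAt 𝓘(ℝ, E) I.tangent ∞ (fun y => (Bundle.TotalSpace.mk' E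
      ((extChartAt I p).symm y) (coordVec I b p y i) : TangentBundle I M)) x := by
  have : IsManifold I 1 M := IsManifold.of_le (n := ∞) (by simp)
  have ho := isOpen_extChartAt_target (I := I) p
  have h1 := (contMDiffOn_extChartAt_symm (I := I) (n := ∞) p).contMDiffOn_tangentMapWithin
    (m := ∞) (by simp) ho.uniqueMDiffOn
  have h2 : ContMDiffAt 𝓘(ℝ, E) 𝓘(ℝ, E).tangent ∞
      (fun y => (Bundle.TotalSpace.mk' E y (b i) : TangentBundle 𝓘(ℝ, E) E)) x :=
    contMDiffAt_vectorSpace_iff_contDiffAt.2 contDiffAt_const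
  have h3 := (h1 (Bundle.TotalSpace.mk' E x (b i)) hx).comp x h2.contMDiffWithinAt
    (s := (extChartAt I p).target) (fun y hy => hy)
  refine (h3.contMDiffAt (ho.mem_nhds hx)).congr_of_eventuallyEq ?_
  filter_upwards [ho.mem_nhds hx] with y hy
  simp only [Function.comp_apply, tangentMapWithin, coordVec]
  rw [mfderivWithin_of_isOpen ho hy]

/-- The components of a smooth tensor field are smooth functions of the coordinates. -/
theorem contDiffAt_tensorComp {B : TensorField2 I M}
    (hB : ContMDiff I (I.prod 𝓘(ℝ, E →L[ℝ] E →L[ℝ] ℝ)) ∞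
      (fun p : M => (Bundle.TotalSpace.mk' (E →L[ℝ] E →L[ℝ] ℝ) p (B p) :
        Bundle.TotalSpace (E →L[ℝ] E →L[ℝ] ℝ)
          (fun p : M => TangentSpace I p →L[ℝ] TangentSpace I p →L[ℝ] ℝ))))
    {p : M} {x : E} (hx : x ∈ (extChartAt I p).target) (i j : ι) :
    ContDiffAt ℝ ∞ (fun y => tensorComp I b B p y i j) x := by
  have : ContMDiffAt 𝓘(ℝ, E) (I.prod 𝓘(ℝ, ℝ)) ∞ (fun y => Bundle.TotalSpace.mk' ℝ
      (E := Bundle.Trivial M ℝ) ((extChartAt I p).symm y) (tensorComp I b B p y i j)) x := by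
    apply ContMDiffAt.clm_bundle_apply₂ (F₁ := E) (F₂ := E)
    · exact ContMDiffAt.comp x hB.contMDiffAt (contMDiffAt_extChartAt_symm hx)
    · exact contMDiffAt_coordVec b hx i
    · exact contMDiffAt_coordVec b hx j
  rw [Bundle.contMDiffAt_totalSpace] at this
  exact contMDiffAt_iff_contDiffAt.1 this.2

theorem tensorComp_self (B : TensorField2 I M) (p : M) (i j : ι) :
    tensorComp I b B p (extChartAt I p p) i j
      = B p (tangentBasis I b p i) (tangentBasis I b p j) := by
  have : IsManifold I 1 M := IsManifold.of_le (n := ∞) (by simp)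
  have h := mfderivWithin_range_extChartAt_symm (I := I) (x := p)
  rw [I.range_eq_univ, mfderivWithin_univ] at h
  have hv : ∀ i, (coordVec I b p (extChartAt I p p) i : E) = b i := fun i =>
    congrArg (fun A : E →L[ℝ] E => A (b i)) h
  have hp : (extChartAt I p).symm (extChartAt I p p) = p := extChartAt_to_inv p
  -- `B` is evaluated at `φ⁻¹ (φ p)` and not at `p`; all tangent spaces being copies of `E`, the
  -- base point can be rewritten after the vectors.
  calc tensorComp I b B p (extChartAt I p p) i j
      = (B ((extChartAt I p).symm (extChartAt I p p)) : E →L[ℝ] E →L[ℝ] ℝ)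
          (coordVec I b p (extChartAt I p p) i : E) (coordVec I b p (extChartAt I p p) j : E) := rfl
    _ = (B ((extChartAt I p).symm (extChartAt I p p)) : E →L[ℝ] E →L[ℝ] ℝ) (b i) (b j) := by
        rw [hv, hv]
    _ = B p (tangentBasis I b p i) (tangentBasis I b p j) :=
        congrArg (fun q : M => (B q : E →L[ℝ] E →L[ℝ] ℝ) (b i) (b j)) hp

end Charts

/-! ### The unit sphere and product charts -/

/-- The standard basis of the model space of the orbit space and of the sphere. -/
def basis2 : Module.Basis (Fin 2) ℝ Plane := (EuclideanSpace.basisFun (Fin 2) ℝ).toBasis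

theorem basis4_inl (A : Fin 2) : basis4 (inl A) = (basis2 A, 0) := by
  simp [basis4, basis2]

theorem basis4_inr (i : Fin 2) : basis4 (inr i) = (0, basis2 i) := by
  simp [basis4, basis2]

theorem mdifferentiableAt_coe_sphere (q : S2) :
    MDifferentiableAt (𝓡 2) 𝓘(ℝ, EuclideanSpace ℝ (Fin 3))
      (fun q : S2 => (q : EuclideanSpace ℝ (Fin 3))) q := by
  have : Fact (Module.finrank ℝ (EuclideanSpace ℝ (Fin 3)) = 2 + 1) := ⟨finrank_euclideanSpace_fin⟩
  exact (contMDiff_coe_sphere (n := 2) (m := 1) q).mdifferentiableAt (by simp)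

/-- The chart of the sphere at `q`, as a parametrization of a surface in Euclidean space. -/
def sphereParam (q : S2) (y : Plane) : EuclideanSpace ℝ (Fin 3) :=
  ((extChartAt (𝓡 2) q).symm y : S2)

/-- The components of the metric of the unit sphere in the chart at `q`. -/
def sphereComp (q : S2) (y : Plane) : Matrix (Fin 2) (Fin 2) ℝ :=
  Matrix.of fun i j =>
    inner ℝ (fderiv ℝ (sphereParam q) y (basis2 i)) (fderiv ℝ (sphereParam q) y (basis2 j))

theorem contDiffAt_sphereParam {q : S2} {y : Plane} (hy : y ∈ (extChartAt (𝓡 2) q).target) :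
    ContDiffAt ℝ ∞ (sphereParam q) y := by
  have : Fact (Module.finrank ℝ (EuclideanSpace ℝ (Fin 3)) = 2 + 1) := ⟨finrank_euclideanSpace_fin⟩
  exact contMDiffAt_iff_contDiffAt.1
    ((contMDiff_coe_sphere (n := 2) (m := ∞)).contMDiffAt.comp y (contMDiffAt_extChartAt_symm hy))

theorem differentiableAt_sphereComp {q : S2} {y : Plane} (hy : y ∈ (extChartAt (𝓡 2) q).target)
    (i j : Fin 2) : DifferentiableAt ℝ (fun y => sphereComp q y i j) y := by
  have h : DifferentiableAt ℝ (fderiv ℝ (sphereParam q)) y :=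
    ((contDiffAt_sphereParam hy).fderiv_right (m := ∞) (by simp)).differentiableAt (by simp)
  exact (h.clm_apply (differentiableAt_const _)).inner ℝ (h.clm_apply (differentiableAt_const _))

/-- The parametrization of the sphere is an immersion, so the induced metric is nondegenerate. -/
theorem sphereComp_det_ne_zero {q : S2} {y : Plane} (hy : y ∈ (extChartAt (𝓡 2) q).target) :
    (sphereComp q y).det ≠ 0 := by
  have : Fact (Module.finrank ℝ (EuclideanSpace ℝ (Fin 3)) = 2 + 1) := ⟨finrank_euclideanSpace_fin⟩
  refine det_gram_ne_zero basis2 (pullbackForm (fderiv ℝ (sphereParam q) y) (innerSL ℝ)) ?_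
  intro v hv
  have h0 : fderiv ℝ (sphereParam q) y v = 0 := inner_self_eq_zero.1 (hv v)
  have h1 := mfderiv_comp y (mdifferentiableAt_coe_sphere _) (mdifferentiableAt_extChartAt_symm hy)
  have h2 : fderiv ℝ (sphereParam q) y v = mfderiv (𝓡 2) 𝓘(ℝ, EuclideanSpace ℝ (Fin 3))
      (fun q : S2 => (q : EuclideanSpace ℝ (Fin 3))) ((extChartAt (𝓡 2) q).symm y)
      (mfderiv 𝓘(ℝ, Plane) (𝓡 2) (extChartAt (𝓡 2) q).symm y v) := by
    rw [mfderiv_eq_fderiv] at h1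
    exact congrArg (fun A : Plane →L[ℝ] EuclideanSpace ℝ (Fin 3) => A v) h1
  have h3 := injective_mvfderiv_subtypeVal_sphere (n := 2) ((extChartAt (𝓡 2) q).symm y)
  have h4 : mfderiv 𝓘(ℝ, Plane) (𝓡 2) (extChartAt (𝓡 2) q).symm y v = 0 := by
    apply h3
    rw [map_zero]
    exact h2.symm.trans h0
  obtain ⟨e, he⟩ := isInvertible_mfderiv_extChartAt_symm (I := 𝓡 2) hy
  rw [← he] at h4
  exact e.map_eq_zero_iff.1 h4

section Product

variable {N : Type*} [TopologicalSpace N] [ChartedSpace Plane N]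

namespace OrbitData

theorem extChartAt_symm_prod (m : N × S2) (z : Plane × Plane) :
    (extChartAt I4 m).symm z
      = ((extChartAt (𝓡 2) m.1).symm z.1, (extChartAt (𝓡 2) m.2).symm z.2) := by
  rw [extChartAt_prod]
  rfl

theorem mem_extChartAt_target_prod {m : N × S2} {z : Plane × Plane} :
    z ∈ (extChartAt I4 m).target
      ↔ z.1 ∈ (extChartAt (𝓡 2) m.1).target ∧ z.2 ∈ (extChartAt (𝓡 2) m.2).target := by
  rw [extChartAt_prod]
  rfl

theorem eventually_mem_target (m : N × S2) :
    ∀ᶠ z in 𝓝 (extChartAt I4 m m), z ∈ (extChartAt I4 m).target :=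
  extChartAt_target_mem_nhds m

theorem dProj_apply (m : N × S2) (v : TangentSpace I4 m) : dProj m v = (v : Plane × Plane).1 := by
  rw [dProj, mfderiv_fst]
  rfl

theorem dIncl_apply (m : N × S2) (v : TangentSpace (𝓡 2) m.1) :
    dIncl m v = ((v, 0) : Plane × Plane) := by
  have := mfderiv_prod_left (I := 𝓡 2) (I' := 𝓡 2) (x₀ := m.1) (y₀ := m.2)
  rw [dIncl, this]
  rfl

theorem dProj_eq_sum (m : N × S2) (v : TangentSpace I4 m) :
    dProj m v = ∑ A, (tangentBasis I4 basis4 m).repr v (inl A) •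
      tangentBasis (𝓡 2) basis2 m.1 A := by
  have h : ∀ u : Plane × Plane, u.1 = ∑ A, basis4.repr u (inl A) • basis2 A := fun u =>
    (basis2.sum_repr u.1).symm
  exact (dProj_apply m v).trans (h v)

theorem dSphere_dIncl (m : N × S2) (v : TangentSpace (𝓡 2) m.1) : dSphere m (dIncl m v) = 0 := by
  have h0 : MDifferentiableAt I4 𝓘(ℝ, EuclideanSpace ℝ (Fin 3))
      (fun x : N × S2 => (x.2 : EuclideanSpace ℝ (Fin 3))) m :=
    (mdifferentiableAt_coe_sphere _).comp _ mdifferentiableAt_snd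
  have h1 : MDifferentiableAt (𝓡 2) I4 (fun p : N => ((p, m.2) : N × S2)) m.1 :=
    mdifferentiableAt_id.prodMk mdifferentiableAt_const
  have h2 := mfderiv_comp m.1 (g := fun x : N × S2 => (x.2 : EuclideanSpace ℝ (Fin 3))) h0 h1
  have h3 : (fun x : N × S2 => (x.2 : EuclideanSpace ℝ (Fin 3))) ∘
      (fun p : N => ((p, m.2) : N × S2)) = fun _ => (m.2 : EuclideanSpace ℝ (Fin 3)) := rfl
  rw [h3, mfderiv_const] at h2
  exact (congrArg (fun A : Plane →L[ℝ] EuclideanSpace ℝ (Fin 3) => A v) h2).symm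

end OrbitData

end Product

/-! ### The orbit space in a chart -/

namespace OrbitData

variable {N : Type*} [TopologicalSpace N] [ChartedSpace Plane N] [IsManifold (𝓡 2) ∞ N]
  (S : OrbitData N)

/-- A vector in the kernel of `G` is orthogonal to the timelike `t`, on whose orthogonal complement
`G` is positive definite. -/
theorem G_nondegenerate (p : N) (v : TangentSpace (𝓡 2) p) (h : ∀ w, S.G p v w = 0) : v = 0 := by
  obtain ⟨t, -, ht⟩ := S.G_lorentz p
  by_contra hv
  have h1 := ht v hv (by rw [S.G_symm, h])
  rw [h] at h1
  exact lt_irrefl _ h1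

variable {S} in
theorem det_gram_G_ne_zero {p : N} (F : Module.Basis (Fin 2) ℝ (TangentSpace (𝓡 2) p)) :
    (Matrix.of fun i j => S.G p (F i) (F j)).det ≠ 0 :=
  det_gram_ne_zero F (S.G p) (S.G_nondegenerate p)

theorem G_sharp (p : N) (η : TangentSpace (𝓡 2) p →L[ℝ] ℝ) : S.G p (S.sharp p η) = η := by
  let F : Module.Basis (Fin 2) ℝ (TangentSpace (𝓡 2) p) := basis2
  have h := (isInvertible_form F (S.G p) (S.G_symm p) _ (fun _ _ => rfl)
    (det_gram_G_ne_zero F)).1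
  exact h.self_apply_inverse η

theorem sharp_apply {p : N} (F : Module.Basis (Fin 2) ℝ (TangentSpace (𝓡 2) p))
    (g : Matrix (Fin 2) (Fin 2) ℝ) (hg : ∀ i j, g i j = S.G p (F i) (F j))
    (η : TangentSpace (𝓡 2) p →L[ℝ] ℝ) :
    S.sharp p η = ∑ C, (∑ D, g⁻¹ C D * η (F D)) • F C := by
  have e : g = Matrix.of fun i j => S.G p (F i) (F j) := by ext i j; exact hg i j
  exact (isInvertible_form F (S.G p) (S.G_symm p) g hg (by rw [e]; exact det_gram_G_ne_zero F)).2 η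

theorem traceG_apply {p : N} (F : Module.Basis (Fin 2) ℝ (TangentSpace (𝓡 2) p))
    (g : Matrix (Fin 2) (Fin 2) ℝ) (hg : ∀ i j, g i j = S.G p (F i) (F j))
    (A : TangentSpace (𝓡 2) p →L[ℝ] TangentSpace (𝓡 2) p →L[ℝ] ℝ) :
    S.traceG p A = ∑ C, ∑ D, g⁻¹ C D * A (F C) (F D) := by
  rw [traceG, LinearMap.trace_eq_matrix_trace ℝ F, Matrix.trace]
  refine Finset.sum_congr rfl fun C _ => ?_
  rw [Matrix.diag_apply, LinearMap.toMatrix_apply]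
  have := S.sharp_apply F g hg (A (F C))
  change F.repr (S.sharp p (A (F C))) C = _
  rw [this]
  exact congrFun (F.repr_sum_self _) C

/-- The components of the metric of the orbit space in the chart at `p`. -/
def Gcomp (p : N) : Plane → Matrix (Fin 2) (Fin 2) ℝ := tensorComp (𝓡 2) basis2 S.G p

/-- The components of `ε` in the chart at `p`. -/
def εcomp (p : N) : Plane → Matrix (Fin 2) (Fin 2) ℝ := tensorComp (𝓡 2) basis2 S.ε p

/-- The areal radius in the chart at `p`. -/
def rcomp (p : N) (x : Plane) : ℝ := S.r ((extChartAt (𝓡 2) p).symm x)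

variable {p : N} {x : Plane}

theorem Gcomp_det_ne_zero (hx : x ∈ (extChartAt (𝓡 2) p).target) : (S.Gcomp p x).det ≠ 0 := by
  obtain ⟨F, hF⟩ := exists_basis_coordVec (I := 𝓡 2) basis2 hx
  have := det_gram_G_ne_zero (S := S) F
  simp only [hF] at this
  exact this

/-- Lowering the index undoes the outer `sharp` in `kodamaOrbit`. -/
theorem lowerComp_kodamaOrbit (hx : x ∈ (extChartAt (𝓡 2) p).target) (B : Fin 2) :
    lowerComp (𝓡 2) basis2 S.G S.kodamaOrbit p x B
      = kodamaComp basis2 (S.Gcomp p) (S.εcomp p) (S.rcomp p) x B := by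
  obtain ⟨F, hF⟩ := exists_basis_coordVec (I := 𝓡 2) basis2 hx
  have hr : ∀ D, S.dr _ (F D) = pderiv basis2 (S.rcomp p) D x := fun D => by
    rw [hF]
    exact mfderiv_coordVec basis2 hx (S.r_smooth.mdifferentiable (by simp) _) D
  have hs := S.sharp_apply F (S.Gcomp p x) (fun i j => by rw [hF, hF]; rfl) (S.dr _)
  rw [lowerComp, kodamaOrbit, G_sharp, hs]
  simp only [hr]
  simp only [map_sum, map_smul, hF]
  rw [FunLike.coe_sum, Finset.sum_apply]
  rfl

/-! ### The spacetime in a product chart -/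

theorem dProj_mfderiv_symm {m : N × S2} {z : Plane × Plane} (hz : z ∈ (extChartAt I4 m).target)
    (v : Plane × Plane) :
    dProj _ (mfderiv 𝓘(ℝ, Plane × Plane) I4 (extChartAt I4 m).symm z v)
      = mfderiv 𝓘(ℝ, Plane) (𝓡 2) (extChartAt (𝓡 2) m.1).symm z.1 v.1 := by
  have hz1 := (mem_extChartAt_target_prod.1 hz).1
  have h1 := mfderiv_comp z (g := (Prod.fst : N × S2 → N)) (I'' := 𝓡 2)
    mdifferentiableAt_fst (mdifferentiableAt_extChartAt_symm hz)
  have h2 := mfderiv_comp z (f := (Prod.fst : Plane × Plane → Plane))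
    (I := 𝓘(ℝ, Plane × Plane)) (I' := 𝓘(ℝ, Plane))
    (mdifferentiableAt_extChartAt_symm hz1) differentiableAt_fst.mdifferentiableAt
  have h3 : (Prod.fst : N × S2 → N) ∘ (extChartAt I4 m).symm
      = (extChartAt (𝓡 2) m.1).symm ∘ Prod.fst := by
    funext y
    simp only [Function.comp_apply, extChartAt_symm_prod]
  rw [h3] at h1
  have h4 := h1.symm.trans h2
  rw [mfderiv_eq_fderiv, fderiv_fst] at h4
  exact congrArg (fun A : Plane × Plane →L[ℝ] Plane => A v) h4

theorem dSphere_mfderiv_symm {m : N × S2} {z : Plane × Plane} (hz : z ∈ (extChartAt I4 m).target)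
    (v : Plane × Plane) :
    dSphere _ (mfderiv 𝓘(ℝ, Plane × Plane) I4 (extChartAt I4 m).symm z v)
      = fderiv ℝ (sphereParam m.2) z.2 v.2 := by
  have hz2 := (mem_extChartAt_target_prod.1 hz).2
  have h0 : MDifferentiableAt I4 𝓘(ℝ, EuclideanSpace ℝ (Fin 3))
      (fun x : N × S2 => (x.2 : EuclideanSpace ℝ (Fin 3))) ((extChartAt I4 m).symm z) :=
    (mdifferentiableAt_coe_sphere _).comp _ mdifferentiableAt_snd
  have h1 := mfderiv_comp z h0 (mdifferentiableAt_extChartAt_symm hz)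
  have hd := (contDiffAt_sphereParam hz2).differentiableAt (by simp)
  have h2 := (hd.hasFDerivAt.comp z hasFDerivAt_snd).fderiv
  have h3 : (fun x : N × S2 => (x.2 : EuclideanSpace ℝ (Fin 3))) ∘ (extChartAt I4 m).symm
      = sphereParam m.2 ∘ Prod.snd := by
    funext y
    simp only [Function.comp_apply, extChartAt_symm_prod, sphereParam]
  rw [h3, mfderiv_eq_fderiv, h2] at h1
  exact (congrArg (fun A : Plane × Plane →L[ℝ] EuclideanSpace ℝ (Fin 3) => A v) h1).symm

theorem dProj_coordVec_inl {m : N × S2} {z : Plane × Plane} (hz : z ∈ (extChartAt I4 m).target)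
    (A : Fin 2) : dProj _ (coordVec I4 basis4 m z (inl A)) = coordVec (𝓡 2) basis2 m.1 z.1 A := by
  refine (dProj_mfderiv_symm hz _).trans ?_
  rw [basis4_inl]
  rfl

theorem dProj_coordVec_inr {m : N × S2} {z : Plane × Plane} (hz : z ∈ (extChartAt I4 m).target)
    (i : Fin 2) : dProj _ (coordVec I4 basis4 m z (inr i)) = 0 := by
  refine (dProj_mfderiv_symm hz _).trans ?_
  rw [basis4_inr]
  exact map_zero _

theorem dSphere_coordVec_inl {m : N × S2} {z : Plane × Plane} (hz : z ∈ (extChartAt I4 m).target)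
    (A : Fin 2) : dSphere _ (coordVec I4 basis4 m z (inl A)) = 0 := by
  refine (dSphere_mfderiv_symm hz _).trans ?_
  rw [basis4_inl]
  exact map_zero _

theorem dSphere_coordVec_inr {m : N × S2} {z : Plane × Plane} (hz : z ∈ (extChartAt I4 m).target)
    (i : Fin 2) : dSphere _ (coordVec I4 basis4 m z (inr i))
      = fderiv ℝ (sphereParam m.2) z.2 (basis2 i) := by
  refine (dSphere_mfderiv_symm hz _).trans ?_
  rw [basis4_inr]

theorem spacetimeMetric_apply (m : N × S2) (v w : TangentSpace I4 m) :
    S.spacetimeMetric m v w = S.G m.1 (dProj m v) (dProj m w)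
      + S.r m.1 ^ 2 * inner ℝ (dSphere m v) (dSphere m w) := rfl

/-- The spacetime metric is a warped product in every product chart. -/
theorem tensorComp_spacetimeMetric {m : N × S2} {z : Plane × Plane}
    (hz : z ∈ (extChartAt I4 m).target) :
    tensorComp I4 basis4 S.spacetimeMetric m z
      = warped (S.Gcomp m.1) (S.rcomp m.1) (sphereComp m.2) z := by
  ext i j
  rw [tensorComp, Matrix.of_apply, spacetimeMetric_apply]
  rcases i with A | i <;> rcases j with B | j
  · rw [dSphere_coordVec_inl hz, inner_zero_left, dProj_coordVec_inl hz, dProj_coordVec_inl hz,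
      mul_zero, add_zero]
    rfl
  · rw [dSphere_coordVec_inl hz, inner_zero_left, dProj_coordVec_inr hz, map_zero, mul_zero,
      add_zero]
    rfl
  · rw [dSphere_coordVec_inl hz, inner_zero_right, dProj_coordVec_inr hz, map_zero, mul_zero,
      add_zero]
    rfl
  · rw [dSphere_coordVec_inr hz, dSphere_coordVec_inr hz, dProj_coordVec_inr hz, map_zero]
    exact zero_add _

/-- The Kodama covector is pulled back from the orbit space. -/
theorem lowerComp_kodama {m : N × S2} {z : Plane × Plane} (hz : z ∈ (extChartAt I4 m).target) :
    lowerComp I4 basis4 S.spacetimeMetric S.kodama m z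
      = Sum.elim (kodamaComp basis2 (S.Gcomp m.1) (S.εcomp m.1) (S.rcomp m.1) z.1) 0 := by
  funext j
  rw [lowerComp, spacetimeMetric_apply, kodama, dSphere_dIncl, inner_zero_left, mul_zero, add_zero,
    dProj_apply, dIncl_apply]
  rcases j with B | j
  · rw [dProj_coordVec_inl hz, Sum.elim_inl,
      ← S.lowerComp_kodamaOrbit (mem_extChartAt_target_prod.1 hz).1]
    rfl
  · rw [dProj_coordVec_inr hz, map_zero]
    rfl

/-! ### The Einstein tensor and the Kodama vector in a product chart -/

theorem Gcomp_symm (p : N) (x : Plane) (A B : Fin 2) : S.Gcomp p x A B = S.Gcomp p x B A :=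
  S.G_symm _ _ _

theorem εcomp_antisymm (p : N) (x : Plane) (A B : Fin 2) :
    S.εcomp p x A B = - S.εcomp p x B A :=
  S.ε_antisymm _ _ _

/-- The normalization of `ε` in coordinates: `ε_{01}² = -det g`. -/
theorem εcomp_sq (p : N) (x : Plane) : S.εcomp p x 0 1 ^ 2 = - (S.Gcomp p x).det := by
  rw [Matrix.det_fin_two, S.Gcomp_symm p x 1 0, ← sq]
  exact S.ε_normalized _ _ _

theorem warpedRegular {m : N × S2} {z : Plane × Plane} (hz : z ∈ (extChartAt I4 m).target) :
    WarpedRegular (S.Gcomp m.1) (S.rcomp m.1) (sphereComp m.2) z where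
  base_det := S.Gcomp_det_ne_zero (mem_extChartAt_target_prod.1 hz).1
  fibre_det := sphereComp_det_ne_zero (mem_extChartAt_target_prod.1 hz).2
  warp_ne_zero := (S.r_pos _).ne'
  warp_diff := (contDiffAt_comp_extChartAt_symm S.r_smooth
    (mem_extChartAt_target_prod.1 hz).1).differentiableAt (by simp)
  fibre_diff := differentiableAt_sphereComp (mem_extChartAt_target_prod.1 hz).2

theorem tensorComp_eventuallyEq (m : N × S2) :
    tensorComp I4 basis4 S.spacetimeMetric m =ᶠ[𝓝 (extChartAt I4 m m)]
      warped (S.Gcomp m.1) (S.rcomp m.1) (sphereComp m.2) :=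
  (eventually_mem_target m).mono fun _ hz => S.tensorComp_spacetimeMetric hz

theorem lowerComp_eventuallyEq (m : N × S2) :
    lowerComp I4 basis4 S.spacetimeMetric S.kodama m =ᶠ[𝓝 (extChartAt I4 m m)]
      fun z => Sum.elim (kodamaComp basis2 (S.Gcomp m.1) (S.εcomp m.1) (S.rcomp m.1) z.1) 0 :=
  (eventually_mem_target m).mono fun _ hz => S.lowerComp_kodama hz

/-- Up to a multiple of the metric, the orbit space components of the Einstein tensor are
`-(2 / r) ∇_A ∂_B r`. -/
theorem exists_einsteinComp_eq (m : N × S2) : ∃ c : ℝ, ∀ A B,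
    einsteinComp basis4 (tensorComp I4 basis4 S.spacetimeMetric m) (inl A) (inl B)
        (extChartAt I4 m m)
      = - (2 / S.r m.1) * hessComp basis2 (S.Gcomp m.1) (S.rcomp m.1) A B
          (extChartAt (𝓡 2) m.1 m.1)
        + c * S.Gcomp m.1 (extChartAt (𝓡 2) m.1 m.1) A B := by
  have hx := mem_extChartAt_target (I := 𝓡 2) m.1
  have hr := contDiffAt_comp_extChartAt_symm S.r_smooth hx
  obtain ⟨c, hc⟩ := exists_ricciComp_eq basis2
    (fun i j => contDiffAt_tensorComp basis2 S.G_smooth hx i j)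
    (Eventually.of_forall fun y => S.Gcomp_symm m.1 y 1 0) (S.Gcomp_det_ne_zero hx)
  refine ⟨c - (1 / 2) * scalarComp basis4 (tensorComp I4 basis4 S.spacetimeMetric m)
    (extChartAt I4 m m), fun A B => ?_⟩
  have hz : (extChartAt I4 m m).1 = extChartAt (𝓡 2) m.1 m.1 := rfl
  have hrr : S.rcomp m.1 (extChartAt (𝓡 2) m.1 m.1) = S.r m.1 := by
    rw [rcomp, extChartAt_to_inv]
  have hR := ricciComp_warped_inl_inl basis2 basis2
    ((eventually_mem_target m).mono fun _ hz => S.warpedRegular hz) hr A B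
  have hw := (S.tensorComp_eventuallyEq m).self_of_nhds
  rw [einsteinComp, ricciComp_congr basis4 (S.tensorComp_eventuallyEq m)]
  rw [show ricciComp basis4 (warped (S.Gcomp m.1) (S.rcomp m.1) (sphereComp m.2)) (inl A) (inl B)
    (extChartAt I4 m m) = _ from hR, hw, hz, hrr,
    show ricciComp basis2 (S.Gcomp m.1) A B _ = _ from hc A B]
  simp only [warped, Matrix.fromBlocks_apply₁₁, Fintype.card_fin, hz]
  change c * S.Gcomp m.1 _ A B - _ - _ = _
  push_cast
  ring

/-- Only the orbit space components of `∇_{(a} K_{b)}` survive, and they are computed with the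
connection of the orbit space. The sphere components vanish because `K` is orthogonal to `grad r`. -/
theorem symCovDerivComp_kodama (m : N × S2) (i j : Fin 2 ⊕ Fin 2) :
    (1 / 2) * (covDerivComp basis4 (tensorComp I4 basis4 S.spacetimeMetric m)
          (lowerComp I4 basis4 S.spacetimeMetric S.kodama m) i j (extChartAt I4 m m)
        + covDerivComp basis4 (tensorComp I4 basis4 S.spacetimeMetric m)
          (lowerComp I4 basis4 S.spacetimeMetric S.kodama m) j i (extChartAt I4 m m))
      = Sum.elim (fun A => Sum.elim (fun B => (1 / 2) *
          (covDerivComp basis2 (S.Gcomp m.1)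
            (kodamaComp basis2 (S.Gcomp m.1) (S.εcomp m.1) (S.rcomp m.1)) A B
              (extChartAt (𝓡 2) m.1 m.1)
          + covDerivComp basis2 (S.Gcomp m.1)
            (kodamaComp basis2 (S.Gcomp m.1) (S.εcomp m.1) (S.rcomp m.1)) B A
              (extChartAt (𝓡 2) m.1 m.1))) 0 j) (fun _ => 0) i := by
  have hz0 := mem_extChartAt_target (I := I4) m
  have hW := S.warpedRegular hz0
  have e : ∀ i j, covDerivComp basis4 (tensorComp I4 basis4 S.spacetimeMetric m)
      (lowerComp I4 basis4 S.spacetimeMetric S.kodama m) i j (extChartAt I4 m m)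
      = covDerivComp (basis2.prod basis2) (warped (S.Gcomp m.1) (S.rcomp m.1) (sphereComp m.2))
        (fun z => Sum.elim (kodamaComp basis2 (S.Gcomp m.1) (S.εcomp m.1) (S.rcomp m.1) z.1) 0)
        i j (extChartAt I4 m m) := fun i j =>
    covDerivComp_congr basis4 (S.tensorComp_eventuallyEq m) (S.lowerComp_eventuallyEq m) i j
  rw [e, e]
  rcases i with A | i <;> rcases j with B | j
  · rw [covDerivComp_warped_inl_inl basis2 basis2 hW, covDerivComp_warped_inl_inl basis2 basis2 hW]
    rfl
  · rw [covDerivComp_warped_inl_inr basis2 basis2 hW, covDerivComp_warped_inr_inl basis2 basis2 hW]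
    simp
  · rw [covDerivComp_warped_inl_inr basis2 basis2 hW, covDerivComp_warped_inr_inl basis2 basis2 hW]
    simp
  · have h0 : ∀ i j, covDerivComp (basis2.prod basis2)
        (warped (S.Gcomp m.1) (S.rcomp m.1) (sphereComp m.2))
        (fun z => Sum.elim (kodamaComp basis2 (S.Gcomp m.1) (S.εcomp m.1) (S.rcomp m.1) z.1) 0)
        (inr i) (inr j) (extChartAt I4 m m) = 0 := fun i j => by
      rw [covDerivComp_warped_inr_inr basis2 basis2 hW]
      have := sum_gradComp_mul_kodamaComp basis2 (g := S.Gcomp m.1) (ρ := S.rcomp m.1)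
        (S.εcomp_antisymm m.1 (extChartAt I4 m m).1)
      simp only [gradComp] at this
      rw [this, mul_zero]
    rw [h0, h0]
    simp

/-- By the Einstein equation, the restriction of `T` to the orbit space has the components of the
Einstein tensor. -/
theorem restrict_apply_basis {T : TensorField2 I4 (N × S2)}
    (hT : EinsteinEquation I4 basis4 S.spacetimeMetric T) (m : N × S2) (A B : Fin 2) :
    8 * Real.pi * restrict T m (tangentBasis (𝓡 2) basis2 m.1 A) (tangentBasis (𝓡 2) basis2 m.1 B)
      = einsteinComp basis4 (tensorComp I4 basis4 S.spacetimeMetric m) (inl A) (inl B)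
        (extChartAt I4 m m) := by
  have e : ∀ A, dIncl m (tangentBasis (𝓡 2) basis2 m.1 A) = tangentBasis I4 basis4 m (inl A) :=
    fun A => (dIncl_apply m _).trans (basis4_inl A).symm
  have e2 : restrict T m (tangentBasis (𝓡 2) basis2 m.1 A) (tangentBasis (𝓡 2) basis2 m.1 B)
      = T m (tangentBasis I4 basis4 m (inl A)) (tangentBasis I4 basis4 m (inl B)) :=
    congrArg₂ (fun v w => T m v w) (e A) (e B)
  rw [e2, ← hT m, einsteinTensor]
  simp [coordComp_self, Finsupp.single_apply]

/-- The components `ε_{AD} g^{DC} 𝒯_{CB}` of the dual. -/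
theorem dualOrbit_apply_basis (T : TensorField2 I4 (N × S2)) (m : N × S2) (A B : Fin 2) :
    S.dualOrbit T m (tangentBasis (𝓡 2) basis2 m.1 A) (tangentBasis (𝓡 2) basis2 m.1 B)
      = ∑ C, ∑ D, S.εcomp m.1 (extChartAt (𝓡 2) m.1 m.1) A D
        * (S.Gcomp m.1 (extChartAt (𝓡 2) m.1 m.1))⁻¹ C D
        * (restrict T m (tangentBasis (𝓡 2) basis2 m.1 C) (tangentBasis (𝓡 2) basis2 m.1 B)
          - (1 / 2) * (∑ C', ∑ D',
          (S.Gcomp m.1 (extChartAt (𝓡 2) m.1 m.1))⁻¹ C' D'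
            * restrict T m (tangentBasis (𝓡 2) basis2 m.1 C') (tangentBasis (𝓡 2) basis2 m.1 D'))
          * S.Gcomp m.1 (extChartAt (𝓡 2) m.1 m.1) C B) := by
  set F := tangentBasis (𝓡 2) basis2 m.1
  have hg : ∀ i j, S.Gcomp m.1 (extChartAt (𝓡 2) m.1 m.1) i j = S.G m.1 (F i) (F j) :=
    tensorComp_self basis2 S.G m.1
  have hε : ∀ i j, S.εcomp m.1 (extChartAt (𝓡 2) m.1 m.1) i j = S.ε m.1 (F i) (F j) :=
    tensorComp_self basis2 S.ε m.1
  have ht : ∀ C, S.traceFree T m (F C) (F B) = restrict T m (F C) (F B) - (1 / 2) * (∑ C', ∑ D',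
      (S.Gcomp m.1 (extChartAt (𝓡 2) m.1 m.1))⁻¹ C' D' * restrict T m (F C') (F D'))
      * S.Gcomp m.1 (extChartAt (𝓡 2) m.1 m.1) C B := fun C => by
    rw [traceFree, S.traceG_apply F _ hg, hg]
    rfl
  rw [dualOrbit, S.sharp_apply F _ hg]
  simp only [map_sum, map_smul]
  rw [FunLike.coe_sum, Finset.sum_apply]
  refine Finset.sum_congr rfl fun C _ => ?_
  rw [FunLike.coe_smul, Pi.smul_apply, smul_eq_mul, ht, Finset.sum_mul]
  refine Finset.sum_congr rfl fun D _ => ?_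
  rw [hε]
  ring

/-- The orbit space components of `∇_{(a} K_{b)} = 4πr 𝒯̃_{ab}`: the multiple of the metric in
`exists_einsteinComp_eq` drops out of the trace-free part. -/
theorem symCovDerivComp_eq_dualOrbit {T : TensorField2 I4 (N × S2)}
    (hT : EinsteinEquation I4 basis4 S.spacetimeMetric T) (m : N × S2) (A B : Fin 2) :
    (1 / 2) * (covDerivComp basis2 (S.Gcomp m.1)
            (kodamaComp basis2 (S.Gcomp m.1) (S.εcomp m.1) (S.rcomp m.1)) A B
              (extChartAt (𝓡 2) m.1 m.1)
          + covDerivComp basis2 (S.Gcomp m.1)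
            (kodamaComp basis2 (S.Gcomp m.1) (S.εcomp m.1) (S.rcomp m.1)) B A
              (extChartAt (𝓡 2) m.1 m.1))
      = 4 * Real.pi * S.r m.1 *
        S.dualOrbit T m (tangentBasis (𝓡 2) basis2 m.1 A) (tangentBasis (𝓡 2) basis2 m.1 B) := by
  have hx := mem_extChartAt_target (I := 𝓡 2) m.1
  obtain ⟨c, hc⟩ := S.exists_einsteinComp_eq m
  have hr := (S.r_pos m.1).ne'
  have hdet := S.Gcomp_det_ne_zero hx
  have hT' : ∀ C D, restrict T m (tangentBasis (𝓡 2) basis2 m.1 C) (tangentBasis (𝓡 2) basis2 m.1 D)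
      = (8 * Real.pi)⁻¹ * (- (2 / S.r m.1) * hessComp basis2 (S.Gcomp m.1) (S.rcomp m.1) C D
          (extChartAt (𝓡 2) m.1 m.1)
        + c * S.Gcomp m.1 (extChartAt (𝓡 2) m.1 m.1) C D) := fun C D => by
    rw [← hc, ← S.restrict_apply_basis hT, inv_mul_cancel_left₀ (by positivity)]
  -- `g^{CD} g_{CD} = 2`, the dimension.
  have htr : ∑ C, ∑ D, (S.Gcomp m.1 (extChartAt (𝓡 2) m.1 m.1))⁻¹ C D
      * S.Gcomp m.1 (extChartAt (𝓡 2) m.1 m.1) C D = 2 := by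
    have h := congrArg Matrix.trace (Matrix.nonsing_inv_mul _ hdet.isUnit)
    rw [Matrix.trace_one, Fintype.card_fin] at h
    rw [show (2 : ℝ) = ((2 : ℕ) : ℝ) by norm_num, ← h, Matrix.trace]
    refine Finset.sum_congr rfl fun C _ => ?_
    rw [Matrix.diag_apply, Matrix.mul_apply]
    exact Finset.sum_congr rfl fun D _ => by rw [S.Gcomp_symm _ _ C D]
  have hK := symCovDeriv_kodamaComp basis2 (g := S.Gcomp m.1) (ε := S.εcomp m.1) (ρ := S.rcomp m.1)
    (contDiffAt_tensorComp basis2 S.G_smooth hx)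
    (Eventually.of_forall fun y => S.Gcomp_symm m.1 y 1 0) hdet
    (contDiffAt_comp_extChartAt_symm S.r_smooth hx)
    (contDiffAt_tensorComp basis2 S.ε_smooth hx 0 1)
    (Eventually.of_forall fun y => S.εcomp_antisymm m.1 y)
    (Eventually.of_forall fun y => S.εcomp_sq m.1 y) A B
  rw [hK, dualOrbit_apply_basis]
  simp only [hT']
  rw [show ∑ C, ∑ D, (S.Gcomp m.1 (extChartAt (𝓡 2) m.1 m.1))⁻¹ C D * ((8 * Real.pi)⁻¹ *
      (- (2 / S.r m.1) * hessComp basis2 (S.Gcomp m.1) (S.rcomp m.1) C D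
          (extChartAt (𝓡 2) m.1 m.1)
        + c * S.Gcomp m.1 (extChartAt (𝓡 2) m.1 m.1) C D))
      = (8 * Real.pi)⁻¹ * (- (2 / S.r m.1) * (∑ C, ∑ D,
        (S.Gcomp m.1 (extChartAt (𝓡 2) m.1 m.1))⁻¹ C D
          * hessComp basis2 (S.Gcomp m.1) (S.rcomp m.1) C D (extChartAt (𝓡 2) m.1 m.1)) + c * 2) by
    rw [← htr]
    simp only [Finset.mul_sum, ← Finset.sum_add_distrib]
    exact Finset.sum_congr rfl fun C _ => Finset.sum_congr rfl fun D _ => by ring]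
  generalize ∑ C, ∑ D, (S.Gcomp m.1 (extChartAt (𝓡 2) m.1 m.1))⁻¹ C D
    * hessComp basis2 (S.Gcomp m.1) (S.rcomp m.1) C D (extChartAt (𝓡 2) m.1 m.1) = τ
  simp only [Finset.mul_sum, ← Finset.sum_neg_distrib]
  refine Finset.sum_congr rfl fun C _ => Finset.sum_congr rfl fun D _ => ?_
  have hpi := Real.pi_ne_zero
  field_simp
  ring

/-- The dual only sees the orbit space components of its arguments. -/
theorem dual_apply (T : TensorField2 I4 (N × S2)) (m : N × S2) (v w : TangentSpace I4 m) :
    S.dual T m v w = ∑ A, ∑ B, (tangentBasis I4 basis4 m).repr v (inl A)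
      * (tangentBasis I4 basis4 m).repr w (inl B)
      * S.dualOrbit T m (tangentBasis (𝓡 2) basis2 m.1 A) (tangentBasis (𝓡 2) basis2 m.1 B) := by
  rw [dual, dProj_eq_sum m v, dProj_eq_sum m w]
  exact form_sum_smul (S.traceFree T m ∘L S.sharp m.1 ∘L S.ε m.1) _ _ _

end OrbitData

end Kodama

end

theorem proposition1 {N : Type*} [TopologicalSpace N] [ChartedSpace Kodama.Plane N]
    [IsManifold (𝓡 2) ∞ N] (S : Kodama.OrbitData N)
    (T : Kodama.TensorField2 Kodama.I4 (N × Kodama.S2))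
    (hT : Kodama.EinsteinEquation Kodama.I4 Kodama.basis4 S.spacetimeMetric T)
    (m : N × Kodama.S2) (v w : TangentSpace Kodama.I4 m) :
    Kodama.symCovDeriv Kodama.I4 Kodama.basis4 S.spacetimeMetric S.kodama m v w
      = 4 * Real.pi * S.r m.1 * S.dual T m v w := by
  rw [Kodama.OrbitData.dual_apply]
  simp only [Kodama.symCovDeriv, Kodama.coordComp_self, S.symCovDerivComp_kodama,
    Fintype.sum_sum_type, Sum.elim_inl, Sum.elim_inr, S.symCovDerivComp_eq_dualOrbit hT,
    Pi.zero_apply, mul_zero, Finset.sum_const_zero, add_zero, Finset.mul_sum]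
  exact Finset.sum_congr rfl fun A _ => Finset.sum_congr rfl fun B _ => by ring
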